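/- Let $\Omega=\{(z,w)\in\mathbb R^2:\ z^2/a^2+w^2/b^2\le 1\}$ with $0<b\le a$, let $\ell=|\partial\Omega|$, and call the curves $C_\lambda=\{z^2/(a^2-\lambda^2)+w^2/(b^2-\lambda^2)=1\}$, $0<\lambda<b$, the confocal ellipses. For $x,y\in\operatorname{int}\Omega$, a broken geodesic with $j$ reflections from $x$ to $y$ is a polygonal path $x,q_1,\dots,q_j,y$ with $q_1,\dots,q_j\in\partial\Omega$ and nondegenerate links that is reflected elastically (angle of incidence equals angle of reflection) at each $q_m$; let $q_{j+1}\in\partial\Omega$ be the next impact point, obtained by continuing the last link beyond $y$. Lift $q_1,\dots,q_{j+1}$ to arclength coordinates $s_1,\dots,s_{j+1}$ on the universal cover $\mathbb R$ of $\partial\Omega\cong\mathbb R/\ell\mathbb Z$ (oriented counterclockwise) so that $0<s_{m+1}-s_m<\ell$ for $1\le m\le j$. The path makes *approximately one counterclockwise rotation* if $|s_{j+1}-\hat y-\ell|\le \ell/100$, where $\hat y$ is an arclength coordinate of $q_{j+1}$ nearest to $s_1$, i.e. $|\hat y-s_1|\le\ell/2$. *Approximately one clockwise rotation* is defined in the same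 way with $-\ell<s_{m+1}-s_m<0$ and $|s_{j+1}-\hat y+\ell|\le\ell/100$. The first link of such a path is of type $T$ if it is tangent to a confocal ellipse at a point of the segment from $x$ to $q_1$, and of type $N$ if it is not, but the next link, from $q_1$ to $q_2$, is tangent to a confocal ellipse at one of its points. The last link is of type $T$ if it is tangent to a confocal ellipse at a point of the segment from $q_j$ to $y$, and of type $N$ if it is not, but its continuation is tangent to a confocal ellipse at a point of the segment from $y$ to $q_{j+1}$. Then there is $J=J(a,b)$ such that for every $j\ge J$ there is an open neighborhood $U\subset\mathbb R^2\times\mathbb R^2$ of the diagonal $\{(p,p):p\in\partial\Omega\}$ of the boundary with the following property. For all $x,y\in\operatorname{int}\Omega$ with $(x,y)\in U$ there are exactly four broken geodesics with $j$ reflections from $x$ to $y$ that make approximately one counterclockwise rotation, and exactly one of them is of each of the types $TT$, $TN$, $NT$, $NN$ (type of the first link, then type of the last link). Likewise, there are exactly four such broken geodesics that make approximately one clockwise rotation, and exactly one of them is of each of these four types. -/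

import Mathlib

noncomputable section

namespace EllipseBilliard

/-- The Euclidean plane. -/
abbrev Plane : Type := EuclideanSpace ℝ (Fin 2)

/-- The open region bounded by the ellipse with semi-axes `a` (horizontal) and `b` (vertical). -/
def ellipseInterior (a b : ℝ) : Set Plane :=
  {p | (p 0) ^ 2 / a ^ 2 + (p 1) ^ 2 / b ^ 2 < 1}

/-- The boundary curve of the ellipse. -/
def ellipseBoundary (a b : ℝ) : Set Plane :=
  {p | (p 0) ^ 2 / a ^ 2 + (p 1) ^ 2 / b ^ 2 = 1}

/-- The confocal ellipse `C_lam`, for `0 < lam < b ≤ a`. -/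
def confocalEllipse (a b lam : ℝ) : Set Plane :=
  {p | (p 0) ^ 2 / (a ^ 2 - lam ^ 2) + (p 1) ^ 2 / (b ^ 2 - lam ^ 2) = 1}

/-- The counterclockwise angular parametrization of the boundary. It identifies the universal
cover of the boundary with `ℝ`. -/
def boundaryPoint (a b φ : ℝ) : Plane := !₂[a * Real.cos φ, b * Real.sin φ]

/-- The arclength coordinate on the universal cover of the boundary, as a function of the
angular parameter. -/
def arclength (a b φ : ℝ) : ℝ :=
  ∫ t in (0 : ℝ)..φ, √(a ^ 2 * Real.sin t ^ 2 + b ^ 2 * Real.cos t ^ 2)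

/-- The length of the boundary. -/
def perimeter (a b : ℝ) : ℝ := arclength a b (2 * Real.pi)

/-- The (non-normalized) outward normal at a boundary point. -/
def outwardNormal (a b : ℝ) (p : Plane) : Plane := !₂[p 0 / a ^ 2, p 1 / b ^ 2]

/-- Reflection of the vector `v` in the line orthogonal to `n`. -/
def reflectAcross (n v : Plane) : Plane := v - (2 * inner ℝ v n / inner ℝ n n) • n

/-- The unit vector pointing from `p` to `q` (for `p ≠ q`). -/
def direction (p q : Plane) : Plane := ‖q - p‖⁻¹ • (q - p)

/-- The vertices `x, q₁, …, q_j, y` of the polygonal path from `x` to `y` through the points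
`q₁, …, q_j`, numbered `0, 1, …, j, j + 1` (here `q_{m+1}` is `q m`). -/
def vertex {j : ℕ} (x y : Plane) (q : Fin j → Plane) : ℕ → Plane
  | 0 => x
  | m + 1 => if h : m < j then q ⟨m, h⟩ else y

/-- The polygonal path `x, q₁, …, q_j, y` is a broken geodesic with `j` reflections in the ellipse:
the `q_m` are on the boundary, every link is nondegenerate, and at each `q_m` the path is reflected
elastically. -/
structure IsBrokenGeodesic (a b : ℝ) {j : ℕ} (x y : Plane) (q : Fin j → Plane) : Prop where
  mem_boundary : ∀ m, q m ∈ ellipseBoundary a b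
  link_ne : ∀ m ≤ j, vertex x y q m ≠ vertex x y q (m + 1)
  reflection : ∀ m < j,
    direction (vertex x y q (m + 1)) (vertex x y q (m + 2)) =
      reflectAcross (outwardNormal a b (vertex x y q (m + 1)))
        (direction (vertex x y q m) (vertex x y q (m + 1)))

/-- The point `z` is where the ray that starts at the boundary point `p` and passes through the
interior point `y` meets the boundary again, after `y`. -/
def IsNextImpact (a b : ℝ) (p y z : Plane) : Prop :=
  z ∈ ellipseBoundary a b ∧ ∃ r : ℝ, 1 < r ∧ z = AffineMap.lineMap p y r

/-- The two senses of rotation. -/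
inductive Sense : Type
  | counterclockwise
  | clockwise

/-- The sign of a sense of rotation: the counterclockwise sense is positive. -/
def Sense.sign : Sense → ℝ
  | counterclockwise => 1
  | clockwise => -1

/-- The angles `φ 0, φ 1, …, φ j` are the successive impact points of the broken geodesic,
lifted to the universal cover: `φ 0, …, φ (j - 1)` lie over `q₁, …, q_j`, and `φ j` lies over the
`(j + 1)`-st impact point, which is reached by continuing the last link beyond `y`.
The lift of the billiard map is the continuous one that fixes the direction tangent to the boundary
in the given sense. A chord joins two distinct boundary points, so by continuity this lift moves
every impact point by more than `0` and less than one full turn in the given sense. -/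
structure IsLiftedOrbit (a b : ℝ) (s : Sense) {j : ℕ} (x y : Plane) (q : Fin j → Plane)
    (φ : ℕ → ℝ) : Prop where
  impact : ∀ m < j, boundaryPoint a b (φ m) = vertex x y q (m + 1)
  next_impact : IsNextImpact a b (vertex x y q j) y (boundaryPoint a b (φ j))
  step_pos : ∀ m < j, 0 < s.sign * (φ (m + 1) - φ m)
  step_lt : ∀ m < j, s.sign * (φ (m + 1) - φ m) < 2 * Real.pi

/-- The broken geodesic makes approximately one rotation in the given sense. With `φ` the lifted
orbit, the first impact point has the arclength coordinate `arclength a b (φ 0)`, its image under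
the `j`-th iterate of the lifted billiard map has the coordinate `arclength a b (φ j)`, and the
coordinate `arclength a b θ` of the `(j + 1)`-st impact point is the one nearest to that of the
first impact point. -/
def MakesApproxOneRotation (a b : ℝ) (s : Sense) {j : ℕ} (x y : Plane) (q : Fin j → Plane) :
    Prop :=
  ∃ (φ : ℕ → ℝ) (θ : ℝ), IsLiftedOrbit a b s x y q φ ∧
    boundaryPoint a b θ = boundaryPoint a b (φ j) ∧
    |arclength a b θ - arclength a b (φ 0)| ≤ perimeter a b / 2 ∧
    |arclength a b (φ j) - arclength a b θ - s.sign * perimeter a b| ≤ perimeter a b / 100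

/-- The broken geodesics from `x` to `y` with `j` reflections that make approximately one rotation
in the given sense, each given by its sequence of reflection points. -/
def oneRotationOrbits (a b : ℝ) (j : ℕ) (x y : Plane) (s : Sense) : Set (Fin j → Plane) :=
  {q | IsBrokenGeodesic a b x y q ∧ MakesApproxOneRotation a b s x y q}

/-- The link from `p` to `p'` has a point of tangency to a confocal ellipse. -/
def LinkIsTangent (a b : ℝ) (p p' : Plane) : Prop :=
  ∃ z ∈ segment ℝ p p', ∃ lam : ℝ, 0 < lam ∧ lam < b ∧ z ∈ confocalEllipse a b lam ∧
    z 0 * (p' - p) 0 / (a ^ 2 - lam ^ 2) + z 1 * (p' - p) 1 / (b ^ 2 - lam ^ 2) = 0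

/-- The types of the first and of the last link: `T` for tangency, `N` for nontangency. -/
inductive LinkType : Type
  | T
  | N

/-- The type of the first link. `T`: the orbit becomes tangent to a confocal ellipse before its
first reflection. `N`: it is first reflected, and then becomes tangent to a confocal ellipse. -/
def FirstLinkHasType (a b : ℝ) {j : ℕ} (x y : Plane) (q : Fin j → Plane) : LinkType → Prop
  | .T => LinkIsTangent a b x (vertex x y q 1)
  | .N => ¬ LinkIsTangent a b x (vertex x y q 1) ∧
      LinkIsTangent a b (vertex x y q 1) (vertex x y q 2)

/-- The type of the last link. `T`: after the last reflection, the orbit becomes tangent to a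
confocal ellipse before it reaches `y`. `N`: it reaches `y` first, and its continuation becomes
tangent to a confocal ellipse between `y` and the next impact point. -/
def LastLinkHasType (a b : ℝ) {j : ℕ} (x y : Plane) (q : Fin j → Plane) : LinkType → Prop
  | .T => LinkIsTangent a b (vertex x y q j) y
  | .N => ¬ LinkIsTangent a b (vertex x y q j) y ∧
      ∃ z, IsNextImpact a b (vertex x y q j) y z ∧ LinkIsTangent a b y z

end EllipseBilliard

end

noncomputable section

namespace EllipseBilliard

open Real Set Filter Topology

/-! In the relative coordinates `(z/a, w/b)` the boundary is the unit circle, and a chord is given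
by its mean angle `m` and half-angle `h`. Elastic reflection preserves the Joachimsthal constant `c
= sin h / speed m`, which is the normal component of the unit direction up to a factor that depends
only on the impact point. So along an orbit `h = arcsin (c * speed m)`, once half-angles near `π`
are excluded, and all chords are tangent to the confocal ellipse with parameter `a * b * c`.

A point with relative polar coordinates `(r, ψ)` lies on such a chord only if `r * cos (ψ - m) = cos
h`, that is, `m = ψ ± arccos (cos h / r)` modulo `2π`. For `r` close to `1` the point lies in an
outer quarter of the chord, whereas the point of tangency lies in the middle half (`sqrt_mem`,
`abs_tangencyParameter_lt`). The sign therefore is the type of the link. An orbit from `x` to `y`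
amounts to two signs and a number `c`, subject to one equation: the last chord passes through the
lift of `y` one turn ahead (`Connects`).

For each pair of signs this equation has exactly one root. The orbit falls short of `y` for `c = c₀`
and overshoots for `c = c₁`, so the intermediate value theorem gives a root (`exists_connects`).
There is only one because of the twist property: raising `c` barely moves the end of a chord that is
next to `x` or `y`, but pushes the far end of every chord forward (`le_end_sub`, `connects_unique`).

Conversely, averaging the half-angles over one rotation forces `c` into `[c₀, c₁]` for every orbit
to be counted (`exists_halfStep_eq`, `exists_connects_of_isChordOrbit`). The clockwise case follows
by reflection in the horizontal axis. -/

/-- The speed of the angular parametrization. -/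
def speed (a b m : ℝ) : ℝ := √(a ^ 2 * sin m ^ 2 + b ^ 2 * cos m ^ 2)

/-! ### Bounds for the speed of the angular parametrization. -/

lemma speed_radicand_pos {a b : ℝ} (hb : 0 < b) (hab : b ≤ a) (m : ℝ) :
    b ^ 2 ≤ a ^ 2 * sin m ^ 2 + b ^ 2 * cos m ^ 2 := by
  have h : b ^ 2 ≤ a ^ 2 := by gcongr
  nlinarith [sin_sq_add_cos_sq m, sq_nonneg (sin m)]

lemma speed_sq {a b : ℝ} (hb : 0 < b) (hab : b ≤ a) (m : ℝ) :
    speed a b m ^ 2 = a ^ 2 * sin m ^ 2 + b ^ 2 * cos m ^ 2 :=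
  sq_sqrt ((sq_nonneg b).trans (speed_radicand_pos hb hab m))

lemma le_speed {a b : ℝ} (hb : 0 < b) (hab : b ≤ a) (m : ℝ) : b ≤ speed a b m :=
  le_sqrt_of_sq_le (speed_radicand_pos hb hab m)

lemma speed_pos {a b : ℝ} (hb : 0 < b) (hab : b ≤ a) (m : ℝ) : 0 < speed a b m :=
  hb.trans_le (le_speed hb hab m)

lemma speed_le {a b : ℝ} (hb : 0 < b) (hab : b ≤ a) (m : ℝ) : speed a b m ≤ a := by
  apply sqrt_le_iff.2 ⟨hb.le.trans hab, ?_⟩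
  have h : b ^ 2 ≤ a ^ 2 := by gcongr
  nlinarith [sin_sq_add_cos_sq m, sq_nonneg (cos m)]

lemma continuous_speed (a b : ℝ) : Continuous (speed a b) := by
  unfold speed; fun_prop

lemma abs_sin_sq_sub_sin_sq_le (x y : ℝ) : |sin x ^ 2 - sin y ^ 2| ≤ |x - y| := by
  have h : sin x ^ 2 - sin y ^ 2 = sin (x - y) * sin (x + y) := by
    rw [sin_sub, sin_add]
    nlinarith [sin_sq_add_cos_sq x, sin_sq_add_cos_sq y]
  rw [h, abs_mul]
  exact (mul_le_mul abs_sin_le_abs (abs_sin_le_one _) (abs_nonneg _) (abs_nonneg _)).trans_eq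
    (mul_one _)

/-- The squared speeds differ by `(a ^ 2 - b ^ 2) * (sin x ^ 2 - sin y ^ 2)`, and the sum of the
speeds is at least `b`. -/
lemma abs_speed_sub_le {a b : ℝ} (hb : 0 < b) (hab : b ≤ a) (x y : ℝ) :
    |speed a b x - speed a b y| ≤ a ^ 2 / b * |x - y| := by
  have hx := le_speed hb hab x
  have hy := le_speed hb hab y
  have h : (speed a b x - speed a b y) * (speed a b x + speed a b y)
      = (a ^ 2 - b ^ 2) * (sin x ^ 2 - sin y ^ 2) := by
    have h1 := speed_sq hb hab x
    have h2 := speed_sq hb hab y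
    have h3 := cos_sq' x
    have h4 := cos_sq' y
    rw [h3] at h1; rw [h4] at h2
    linear_combination h1 - h2
  have hsq : b ^ 2 ≤ a ^ 2 := by gcongr
  have h' := congrArg abs h
  rw [abs_mul, abs_mul, abs_of_nonneg (by linarith : 0 ≤ a ^ 2 - b ^ 2),
    abs_of_pos (by linarith : 0 < speed a b x + speed a b y)] at h'
  rw [div_mul_eq_mul_div, le_div_iff₀ hb]
  calc |speed a b x - speed a b y| * b
      ≤ |speed a b x - speed a b y| * (speed a b x + speed a b y) := by gcongr; linarith
    _ = (a ^ 2 - b ^ 2) * |sin x ^ 2 - sin y ^ 2| := h'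
    _ ≤ a ^ 2 * |x - y| := mul_le_mul (by nlinarith) (abs_sin_sq_sub_sin_sq_le x y)
        (abs_nonneg _) (sq_nonneg _)

/-! ### The arclength -/

lemma hasDerivAt_arclength (a b φ : ℝ) : HasDerivAt (arclength a b) (speed a b φ) φ :=
  (continuous_speed a b).integral_hasStrictDerivAt 0 φ |>.hasDerivAt

lemma arclength_strictMono {a b : ℝ} (hb : 0 < b) (hab : b ≤ a) : StrictMono (arclength a b) :=
  strictMono_of_hasDerivAt_pos (hasDerivAt_arclength a b) (speed_pos hb hab)

/-- The speed has period `π` by central symmetry. Hence half the perimeter is the arclength of a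
half turn from any point, which turns the nearest-lift condition into one on angles. -/
lemma arclength_add_pi (a b φ : ℝ) :
    arclength a b (φ + π) = arclength a b φ + arclength a b π := by
  have hc : ∀ u v : ℝ, IntervalIntegrable (speed a b) MeasureTheory.volume u v :=
    fun u v => (continuous_speed a b).intervalIntegrable u v
  have h1 : arclength a b (φ + π) = arclength a b π + ∫ t in π..(φ + π), speed a b t :=
    (intervalIntegral.integral_add_adjacent_intervals (hc 0 π) (hc π (φ + π))).symm
  have h2 : ∫ t in π..(φ + π), speed a b t = arclength a b φ := by
    have := intervalIntegral.integral_comp_add_right (a := 0) (b := φ) (speed a b) π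
    rw [zero_add] at this
    rw [← this]
    simp [arclength, speed]
  rw [h1, h2, add_comm]

lemma perimeter_eq (a b : ℝ) : perimeter a b = 2 * arclength a b π := by
  have := arclength_add_pi a b π
  rw [perimeter, two_mul, this, two_mul]

lemma arclength_add_two_pi (a b φ : ℝ) :
    arclength a b (φ + 2 * π) = arclength a b φ + perimeter a b := by
  rw [perimeter_eq, show φ + 2 * π = φ + π + π by ring, arclength_add_pi, arclength_add_pi]; ring

lemma arclength_add_int_mul (a b φ : ℝ) (n : ℤ) :
    arclength a b (φ + n * (2 * π)) = arclength a b φ + n * perimeter a b := by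
  induction n using Int.induction_on with
  | zero => simp
  | succ n ih =>
    push_cast at ih ⊢
    rw [show φ + ((n : ℝ) + 1) * (2 * π) = φ + n * (2 * π) + 2 * π by ring,
      arclength_add_two_pi, ih]; ring
  | pred n ih =>
    have := arclength_add_two_pi a b (φ + ((-(n : ℤ) - 1 : ℤ) : ℝ) * (2 * π))
    push_cast at ih this ⊢
    rw [show φ + (-(n : ℝ) - 1) * (2 * π) + 2 * π = φ + -(n : ℝ) * (2 * π) by ring, ih] at this
    linarith

lemma perimeter_pos {a b : ℝ} (hb : 0 < b) (hab : b ≤ a) : 0 < perimeter a b := by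
  have h : arclength a b 0 < perimeter a b := arclength_strictMono hb hab (by positivity)
  simpa [arclength] using h

/-- Angles differing by at most half a turn from one full turn, in terms of the arclength. -/
lemma abs_arclength_sub_le_iff {a b : ℝ} (hb : 0 < b) (hab : b ≤ a) (θ φ : ℝ) :
    |arclength a b θ - arclength a b φ| ≤ perimeter a b / 2 ↔ |θ - φ| ≤ π := by
  have hm := arclength_strictMono hb hab
  have e : perimeter a b / 2 = arclength a b π := by rw [perimeter_eq]; ring
  have h1 := arclength_add_pi a b θ
  have h2 := arclength_add_pi a b φ
  rw [abs_sub_le_iff, abs_sub_le_iff, e, sub_le_iff_le_add, sub_le_iff_le_add,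
    add_comm _ (arclength a b φ), add_comm _ (arclength a b θ), ← h1, ← h2, hm.le_iff_le, hm.le_iff_le, sub_le_iff_le_add,
    sub_le_iff_le_add, add_comm φ, add_comm θ]

/-! ### The half-step of a chord tangent to a caustic -/

lemma abs_arcsin_sub_le {u v : ℝ} (hu : |u| ≤ 1 / 2) (hv : |v| ≤ 1 / 2) :
    |arcsin u - arcsin v| ≤ 2 * |u - v| := by
  have hd : ∀ x ∈ Icc (-(1 / 2) : ℝ) (1 / 2), HasDerivWithinAt arcsin (1 / √(1 - x ^ 2))
      (Icc (-(1 / 2) : ℝ) (1 / 2)) x := fun x hx =>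
    (hasDerivAt_arcsin (by linarith [hx.1]) (by linarith [hx.2])).hasDerivWithinAt
  have hbd : ∀ x ∈ Icc (-(1 / 2) : ℝ) (1 / 2), ‖1 / √(1 - x ^ 2)‖ ≤ 2 := by
    intro x hx
    have : 1 / 2 ≤ √(1 - x ^ 2) := le_sqrt_of_sq_le (by nlinarith [hx.1, hx.2])
    rw [norm_of_nonneg (by positivity), div_le_iff₀ (by linarith)]
    linarith
  exact (convex_Icc _ _).norm_image_sub_le_of_norm_hasDerivWithin_le hd hbd (abs_le.1 hv)
    (abs_le.1 hu)

/-- The sine is 1-Lipschitz, so its inverse expands distances. This is the source of the twist. -/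
lemma sub_le_arcsin_sub {u v : ℝ} (hu : -1 ≤ u) (huv : u ≤ v) (hv : v ≤ 1) :
    v - u ≤ arcsin v - arcsin u := by
  have h : arcsin u ≤ arcsin v := monotone_arcsin huv
  have := abs_sin_sub_sin_le (arcsin v) (arcsin u)
  rw [sin_arcsin (by linarith) hv, sin_arcsin hu (by linarith), abs_of_nonneg (by linarith),
    abs_of_nonneg (by linarith)] at this
  exact this

/-- Half of the increment of the angle along the counterclockwise chord with mean angle `m` and
Joachimsthal constant `c`. -/
def halfStep (a b c m : ℝ) : ℝ := arcsin (c * speed a b m)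

lemma continuous_halfStep (a b : ℝ) : Continuous fun p : ℝ × ℝ => halfStep a b p.1 p.2 := by
  unfold halfStep
  exact continuous_arcsin.comp (continuous_fst.mul ((continuous_speed a b).comp continuous_snd))

/-- The smallness conditions on a range `[c₀, c₁]` of Joachimsthal constants. -/
structure SmallRange (a b c₀ c₁ : ℝ) : Prop where
  b_pos : 0 < b
  b_le : b ≤ a
  lower_pos : 0 < c₀
  lower_le : c₀ ≤ c₁
  -- The remaining three bounds serve as follows: half-steps are at most `1/10`; the half-step is
  -- `1/4`-Lipschitz in the mean angle; the sine of a half-angle is small enough for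
  -- `tangential_sign`.
  mul_a_le : c₁ * a ≤ 1 / 20
  lipschitz : 2 * c₁ * (a ^ 2 / b) ≤ 1 / 4
  threshold : ((a ^ 2 - b ^ 2) / (a ^ 2 + b ^ 2)) ^ 2 + (c₁ * a) ^ 2 < 1

namespace SmallRange

variable {a b c₀ c₁ : ℝ}

lemma a_pos (hS : SmallRange a b c₀ c₁) : 0 < a := hS.b_pos.trans_le hS.b_le

lemma mul_speed_le (hS : SmallRange a b c₀ c₁) {c : ℝ} (hc : c ∈ Icc c₀ c₁) (m : ℝ) :
    c * speed a b m ≤ 1 / 20 :=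
  (mul_le_mul hc.2 (speed_le hS.b_pos hS.b_le m) (speed_pos hS.b_pos hS.b_le m).le
    (hS.lower_pos.le.trans hS.lower_le)).trans hS.mul_a_le

lemma mul_speed_pos (hS : SmallRange a b c₀ c₁) {c : ℝ} (hc : c ∈ Icc c₀ c₁) (m : ℝ) :
    0 < c * speed a b m :=
  mul_pos (hS.lower_pos.trans_le hc.1) (speed_pos hS.b_pos hS.b_le m)

lemma mul_b_le_mul_speed (hS : SmallRange a b c₀ c₁) {c : ℝ} (hc : c ∈ Icc c₀ c₁) (m : ℝ) :
    c * b ≤ c * speed a b m :=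
  mul_le_mul_of_nonneg_left (le_speed hS.b_pos hS.b_le m) (hS.lower_pos.trans_le hc.1).le

lemma sin_halfStep (hS : SmallRange a b c₀ c₁) {c : ℝ} (hc : c ∈ Icc c₀ c₁) (m : ℝ) :
    sin (halfStep a b c m) = c * speed a b m :=
  sin_arcsin (by linarith [hS.mul_speed_pos hc m]) (by linarith [hS.mul_speed_le hc m])

lemma mul_b_le_halfStep (hS : SmallRange a b c₀ c₁) {c : ℝ} (hc : c ∈ Icc c₀ c₁) (m : ℝ) :
    c * b ≤ halfStep a b c m := by
  refine (hS.mul_b_le_mul_speed hc m).trans ?_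
  have := sub_le_arcsin_sub (u := 0) (v := c * speed a b m) (by norm_num)
    (hS.mul_speed_pos hc m).le (by linarith [hS.mul_speed_le hc m])
  simpa [halfStep] using this

lemma halfStep_pos (hS : SmallRange a b c₀ c₁) {c : ℝ} (hc : c ∈ Icc c₀ c₁) (m : ℝ) :
    0 < halfStep a b c m :=
  (mul_pos (hS.lower_pos.trans_le hc.1) hS.b_pos).trans_le (hS.mul_b_le_halfStep hc m)

lemma halfStep_le_two_mul (hS : SmallRange a b c₀ c₁) {c : ℝ} (hc : c ∈ Icc c₀ c₁) (m : ℝ) :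
    halfStep a b c m ≤ 2 * (c * a) := by
  have hw := hS.mul_speed_pos hc m
  have h := abs_arcsin_sub_le (u := c * speed a b m) (v := 0)
    (abs_le.2 ⟨by linarith, by linarith [hS.mul_speed_le hc m]⟩) (by norm_num)
  rw [arcsin_zero, sub_zero, sub_zero, abs_of_pos hw] at h
  calc halfStep a b c m ≤ 2 * (c * speed a b m) := (le_abs_self _).trans h
    _ ≤ 2 * (c * a) := by
      have := speed_le hS.b_pos hS.b_le m
      have := hS.lower_pos.trans_le hc.1
      gcongr

lemma halfStep_le (hS : SmallRange a b c₀ c₁) {c : ℝ} (hc : c ∈ Icc c₀ c₁) (m : ℝ) :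
    halfStep a b c m ≤ 1 / 10 := by
  have h := hS.halfStep_le_two_mul hc m
  have : c * a ≤ c₁ * a := mul_le_mul_of_nonneg_right hc.2 hS.a_pos.le
  linarith [hS.mul_a_le]

/-- The implicit equations for mean angles become contractions: `offset` at most doubles this
constant, which leaves `1/2`. -/
lemma abs_halfStep_sub_le (hS : SmallRange a b c₀ c₁) {c : ℝ} (hc : c ∈ Icc c₀ c₁) (m n : ℝ) :
    |halfStep a b c m - halfStep a b c n| ≤ 1 / 4 * |m - n| := by
  have hc0 : 0 < c := hS.lower_pos.trans_le hc.1
  have hb := hS.b_pos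
  have h : ∀ k, |c * speed a b k| ≤ 1 / 2 := fun k =>
    abs_le.2 ⟨by linarith [hS.mul_speed_pos hc k], by linarith [hS.mul_speed_le hc k]⟩
  calc |halfStep a b c m - halfStep a b c n| ≤ 2 * |c * speed a b m - c * speed a b n| :=
        abs_arcsin_sub_le (h m) (h n)
    _ = 2 * c * |speed a b m - speed a b n| := by
        rw [← mul_sub, abs_mul, abs_of_pos hc0]; ring
    _ ≤ 2 * c * (a ^ 2 / b * |m - n|) := by
        gcongr; exact abs_speed_sub_le hS.b_pos hS.b_le m n
    _ = 2 * c * (a ^ 2 / b) * |m - n| := by ring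
    _ ≤ 1 / 4 * |m - n| := by
        gcongr
        refine le_trans ?_ hS.lipschitz
        gcongr
        exact hc.2

lemma le_halfStep_sub (hS : SmallRange a b c₀ c₁) {c c' : ℝ} (hc : c ∈ Icc c₀ c₁)
    (hc' : c' ∈ Icc c₀ c₁) (h : c ≤ c') (m : ℝ) :
    (c' - c) * b ≤ halfStep a b c' m - halfStep a b c m := by
  have hs := le_speed hS.b_pos hS.b_le m
  have h1 := sub_le_arcsin_sub (u := c * speed a b m) (v := c' * speed a b m)
    (by linarith [hS.mul_speed_pos hc m])
    (mul_le_mul_of_nonneg_right h (by linarith [hS.b_pos]))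
    (by linarith [hS.mul_speed_le hc' m])
  have : (c' - c) * b ≤ (c' - c) * speed a b m := mul_le_mul_of_nonneg_left hs (by linarith)
  unfold halfStep
  linarith

lemma halfStep_sub_le (hS : SmallRange a b c₀ c₁) {c c' : ℝ} (hc : c ∈ Icc c₀ c₁)
    (hc' : c' ∈ Icc c₀ c₁) (h : c ≤ c') (m : ℝ) :
    |halfStep a b c' m - halfStep a b c m| ≤ 2 * ((c' - c) * a) := by
  have hk : ∀ d ∈ Icc c₀ c₁, |d * speed a b m| ≤ 1 / 2 := fun d hd =>
    abs_le.2 ⟨by linarith [hS.mul_speed_pos hd m], by linarith [hS.mul_speed_le hd m]⟩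
  have h1 := abs_arcsin_sub_le (hk c' hc') (hk c hc)
  rw [← sub_mul, abs_mul, abs_of_nonneg (sub_nonneg.2 h),
    abs_of_pos (speed_pos hS.b_pos hS.b_le m)] at h1
  refine h1.trans ?_
  have := speed_le hS.b_pos hS.b_le m
  have : (c' - c) * speed a b m ≤ (c' - c) * a := mul_le_mul_of_nonneg_left this (by linarith)
  linarith

end SmallRange

/-! ### Chords through a point near the boundary. -/

/-- The angular distance from a point at relative distance `r` from the centre, to the midpoint of
a chord of half-angle `h` through this point. -/
def offset (r h : ℝ) : ℝ := arccos (cos h / r)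

lemma continuous_offset (r : ℝ) : Continuous (offset r) := by
  unfold offset
  exact continuous_arccos.comp (continuous_cos.div_const r)

/-- The relative distance `r` from the centre is so close to `1` that a point at this distance sees
the boundary and all chords with Joachimsthal constant at least `c₀` as a boundary point does. -/
structure NearOne (a b c₀ r : ℝ) : Prop where
  pos : 0 < r
  lt_one : r < 1
  one_sub_sq_le : 1 - r ^ 2 ≤ (c₀ * b) ^ 2 * (b / (16 * a))

lemma hasDerivAt_offset {r h : ℝ} (hr : 0 < r) (hh : cos h ^ 2 < r ^ 2) :
    HasDerivAt (offset r) (sin h / √(r ^ 2 - cos h ^ 2)) h := by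
  have habs : |cos h / r| < 1 := by
    rw [abs_div, abs_of_pos hr, div_lt_one hr]
    exact abs_lt_of_sq_lt_sq hh hr.le
  have h1 := (hasDerivAt_arccos (x := cos h / r) (abs_lt.1 habs).1.ne' (abs_lt.1 habs).2.ne).comp h
    ((hasDerivAt_cos h).div_const r)
  refine HasDerivAt.congr_deriv (f := offset r) h1 ?_
  have e : √(r ^ 2 - cos h ^ 2) = r * √(1 - (cos h / r) ^ 2) := by
    rw [← sqrt_sq hr.le, ← sqrt_mul (by positivity), sqrt_sq hr.le]
    congr 1
    field_simp
  rw [e]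
  have : √(1 - (cos h / r) ^ 2) ≠ 0 := by
    apply (sqrt_pos.2 _).ne'
    have := (sq_lt_one_iff_abs_lt_one (cos h / r)).2 habs
    linarith
  field_simp

namespace SmallRange

variable {a b c₀ c₁ : ℝ}

lemma lower_mul_b_pos (hS : SmallRange a b c₀ c₁) : 0 < c₀ * b := mul_pos hS.lower_pos hS.b_pos

lemma lower_mul_b_le (hS : SmallRange a b c₀ c₁) : c₀ * b ≤ 1 / 20 :=
  (mul_le_mul hS.lower_le hS.b_le hS.b_pos.le (hS.lower_pos.le.trans hS.lower_le)).trans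
    hS.mul_a_le

lemma halfStep_mem (hS : SmallRange a b c₀ c₁) {c : ℝ} (hc : c ∈ Icc c₀ c₁) (m : ℝ) :
    halfStep a b c m ∈ Icc (arcsin (c₀ * b)) (1 / 10) := by
  refine ⟨monotone_arcsin ?_, hS.halfStep_le hc m⟩
  refine le_trans ?_ (hS.mul_b_le_mul_speed hc m)
  have := hS.b_pos
  have := hc.1
  gcongr

lemma le_sin_of_mem (hS : SmallRange a b c₀ c₁) {h : ℝ} (hh : h ∈ Icc (arcsin (c₀ * b)) (1 / 10)) :
    c₀ * b ≤ sin h := by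
  have h0 := hS.lower_mul_b_pos
  have h1 := hS.lower_mul_b_le
  have h2 := pi_gt_three
  rw [← sin_arcsin (x := c₀ * b) (by linarith) (by linarith)]
  exact sin_le_sin_of_le_of_le_pi_div_two (neg_pi_div_two_le_arcsin _) (by linarith [hh.2]) hh.1

lemma pos_of_mem (hS : SmallRange a b c₀ c₁) {h : ℝ} (hh : h ∈ Icc (arcsin (c₀ * b)) (1 / 10)) :
    0 < h := (arcsin_pos.2 hS.lower_mul_b_pos).trans_le hh.1

lemma one_sub_sq_le_sin_sq (hS : SmallRange a b c₀ c₁) {r : ℝ} (hr : NearOne a b c₀ r)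
    {h : ℝ} (hh : h ∈ Icc (arcsin (c₀ * b)) (1 / 10)) :
    1 - r ^ 2 ≤ sin h ^ 2 * (b / (16 * a)) := by
  refine hr.one_sub_sq_le.trans ?_
  have := hS.le_sin_of_mem hh
  have := hS.lower_mul_b_pos
  have := hS.a_pos
  have := hS.b_pos
  gcongr

lemma div_le_one_eighth (hS : SmallRange a b c₀ c₁) : b / (8 * a) ≤ 1 / 8 := by
  have := hS.a_pos
  rw [div_le_div_iff₀ (by positivity) (by norm_num)]
  linarith [hS.b_le]

lemma four_mul_one_sub_sq_lt (hS : SmallRange a b c₀ c₁) {r : ℝ} (hr : NearOne a b c₀ r)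
    {h : ℝ} (hh : h ∈ Icc (arcsin (c₀ * b)) (1 / 10)) :
    4 * (1 - r ^ 2) < sin h ^ 2 := by
  have h1 := hS.one_sub_sq_le_sin_sq hr hh
  have h2 : b / (16 * a) ≤ 1 / 16 := by
    have := hS.a_pos
    rw [div_le_div_iff₀ (by positivity) (by norm_num)]
    linarith [hS.b_le]
  have h3 : 0 < sin h := hS.lower_mul_b_pos.trans_le (hS.le_sin_of_mem hh)
  nlinarith [sq_pos_of_pos h3]

lemma cos_sq_lt (hS : SmallRange a b c₀ c₁) {r : ℝ} (hr : NearOne a b c₀ r)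
    {h : ℝ} (hh : h ∈ Icc (arcsin (c₀ * b)) (1 / 10)) : cos h ^ 2 < r ^ 2 := by
  have h1 := hS.four_mul_one_sub_sq_lt hr hh
  have h2 : r ^ 2 < 1 := by nlinarith [hr.pos, hr.lt_one]
  nlinarith [sin_sq_add_cos_sq h]

lemma cos_pos_of_mem (hS : SmallRange a b c₀ c₁) {h : ℝ}
    (hh : h ∈ Icc (arcsin (c₀ * b)) (1 / 10)) : 0 < cos h :=
  cos_pos_of_mem_Ioo ⟨by linarith [hS.pos_of_mem hh, pi_gt_three], by linarith [hh.2, pi_gt_three]⟩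

lemma cos_offset (hS : SmallRange a b c₀ c₁) {r : ℝ} (hr : NearOne a b c₀ r)
    {h : ℝ} (hh : h ∈ Icc (arcsin (c₀ * b)) (1 / 10)) : r * cos (offset r h) = cos h := by
  have h1 := hS.cos_sq_lt hr hh
  have h2 := hS.cos_pos_of_mem hh
  have h3 : cos h < r := lt_of_pow_lt_pow_left₀ 2 hr.pos.le h1
  have h4 : 0 ≤ cos h / r := div_nonneg h2.le hr.pos.le
  rw [offset, cos_arccos (by linarith) ((div_le_one hr.pos).2 h3.le)]
  field_simp [hr.pos.ne']

lemma offset_nonneg (r h : ℝ) : 0 ≤ offset r h := arccos_nonneg _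

lemma offset_le (hS : SmallRange a b c₀ c₁) {r : ℝ} (hr : NearOne a b c₀ r)
    {h : ℝ} (hh : h ∈ Icc (arcsin (c₀ * b)) (1 / 10)) : offset r h ≤ h := by
  have h2 := hS.cos_pos_of_mem hh
  have h3 := hS.pos_of_mem hh
  conv_rhs => rw [← arccos_cos h3.le (by linarith [hh.2, pi_gt_three])]
  apply antitone_arccos
  rw [le_div_iff₀ hr.pos]
  nlinarith [hr.lt_one]

lemma sin_offset (hS : SmallRange a b c₀ c₁) {r : ℝ} (hr : NearOne a b c₀ r)
    {h : ℝ} (hh : h ∈ Icc (arcsin (c₀ * b)) (1 / 10)) :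
    r * sin (offset r h) = √(r ^ 2 - cos h ^ 2) := by
  have h1 := hS.cos_offset hr hh
  have h2 : 0 ≤ sin (offset r h) :=
    sin_nonneg_of_nonneg_of_le_pi (offset_nonneg r h) (arccos_le_pi _)
  rw [eq_comm, sqrt_eq_iff_mul_self_eq (by linarith [hS.cos_sq_lt hr hh])
    (mul_nonneg hr.pos.le h2), ← h1]
  nlinarith [sin_sq_add_cos_sq (offset r h)]

/-- For a boundary point `offset 1 h = h` exactly. For `r` near `1` the derivative of the difference
is `sin t / √(sin t ^ 2 - (1 - r ^ 2)) - 1`, which lies between `0` and `b / (8 * a)`. -/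
lemma abs_offset_sub_sub_le (hS : SmallRange a b c₀ c₁) {r : ℝ} (hr : NearOne a b c₀ r)
    {h h' : ℝ} (hh : h ∈ Icc (arcsin (c₀ * b)) (1 / 10))
    (hh' : h' ∈ Icc (arcsin (c₀ * b)) (1 / 10)) :
    |(offset r h' - h') - (offset r h - h)| ≤ b / (8 * a) * |h' - h| := by
  have hd : ∀ t ∈ Icc (arcsin (c₀ * b)) (1 / 10), HasDerivWithinAt (fun t => offset r t - t)
      (sin t / √(r ^ 2 - cos t ^ 2) - 1) (Icc (arcsin (c₀ * b)) (1 / 10)) t := fun t ht =>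
    ((hasDerivAt_offset hr.pos (hS.cos_sq_lt hr ht)).sub (hasDerivAt_id t)).hasDerivWithinAt
  refine (convex_Icc _ _).norm_image_sub_le_of_norm_hasDerivWithin_le hd (fun t ht => ?_) hh hh'
  have hs : 0 < sin t := hS.lower_mul_b_pos.trans_le (hS.le_sin_of_mem ht)
  have hk := hS.one_sub_sq_le_sin_sq hr ht
  have he := hS.div_le_one_eighth
  set ε := b / (8 * a) with hε
  have hε0 : 0 < ε := div_pos hS.b_pos (by linarith [hS.a_pos])
  have e2 : b / (16 * a) = ε / 2 := by rw [hε]; field_simp; ring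
  rw [e2] at hk
  have hr1 : r ^ 2 < 1 := by nlinarith [hr.pos, hr.lt_one]
  have hD : 0 < √(r ^ 2 - cos t ^ 2) := sqrt_pos.2 (by linarith [hS.cos_sq_lt hr ht])
  have hD2 : √(r ^ 2 - cos t ^ 2) ^ 2 = sin t ^ 2 - (1 - r ^ 2) := by
    rw [sq_sqrt (by linarith [hS.cos_sq_lt hr ht])]; nlinarith [sin_sq_add_cos_sq t]
  set D := √(r ^ 2 - cos t ^ 2)
  rw [norm_eq_abs, abs_le]
  constructor
  · have : 1 ≤ sin t / D := by
      rw [le_div_iff₀ hD, one_mul]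
      exact le_of_sq_le_sq (by linarith) hs.le
    linarith
  -- After squaring, `1 - r ^ 2 ≤ sin t ^ 2 * (ε / 2)` reduces the bound to `1 ≤ (1 + ε) ^ 2 * (1 -
  -- ε / 2)`.
  · rw [sub_le_iff_le_add, div_le_iff₀ hD]
    refine le_of_sq_le_sq ?_ (by positivity)
    rw [mul_pow, hD2]
    have h1 : sin t ^ 2 * (1 - ε / 2) ≤ sin t ^ 2 - (1 - r ^ 2) := by linarith
    have h2 : 1 ≤ (ε + 1) ^ 2 * (1 - ε / 2) := by
      nlinarith [mul_nonneg hε0.le (by nlinarith : 0 ≤ 3 - ε ^ 2)]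
    calc sin t ^ 2 ≤ sin t ^ 2 * ((ε + 1) ^ 2 * (1 - ε / 2)) :=
          le_mul_of_one_le_right (sq_nonneg _) h2
      _ = (ε + 1) ^ 2 * (sin t ^ 2 * (1 - ε / 2)) := by ring
      _ ≤ _ := by gcongr

lemma abs_offset_sub_le (hS : SmallRange a b c₀ c₁) {r : ℝ} (hr : NearOne a b c₀ r)
    {h h' : ℝ} (hh : h ∈ Icc (arcsin (c₀ * b)) (1 / 10))
    (hh' : h' ∈ Icc (arcsin (c₀ * b)) (1 / 10)) :
    |offset r h' - offset r h| ≤ 2 * |h' - h| := by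
  have h1 := hS.abs_offset_sub_sub_le hr hh hh'
  have h2 := hS.div_le_one_eighth
  have h3 : b / (8 * a) * |h' - h| ≤ 1 / 8 * |h' - h| := by gcongr
  have h4 : |offset r h' - offset r h| ≤ |(offset r h' - h') - (offset r h - h)| + |h' - h| := by
    refine le_trans (le_of_eq ?_) (abs_add_le _ _)
    congr 1; ring
  linarith [abs_nonneg (h' - h)]

end SmallRange

/-! ### The equations of an orbit, and uniqueness by the twist property. -/

/-- `1` for tangency, `-1` for nontangency. -/
def LinkType.sign : LinkType → ℝ
  | T => 1
  | N => -1

lemma LinkType.abs_sign (t : LinkType) : |t.sign| = 1 := by cases t <;> simp [LinkType.sign]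

/-- The chords with Joachimsthal constant `c` and mean angles `m 0, …, m j` are the links of a
billiard orbit around the boundary once, from the point with relative polar coordinates `(r, ψ)` to
the point with relative polar coordinates `(r', ψ')`. -/
structure Connects (a b c₀ c₁ r ψ r' ψ' : ℝ) (j : ℕ) (first last : LinkType) (c : ℝ)
    (m : ℕ → ℝ) : Prop where
  mem : c ∈ Icc c₀ c₁
  step : ∀ k < j, m (k + 1) - halfStep a b c (m (k + 1)) = m k + halfStep a b c (m k)
  start : m 0 = ψ + first.sign * offset r (halfStep a b c (m 0))
  finish : m j = ψ' + 2 * π - last.sign * offset r' (halfStep a b c (m j))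

namespace SmallRange

variable {a b c₀ c₁ : ℝ}

/-- The displacement of the end of a chord through a given point near the boundary, when the
Joachimsthal constant varies. -/
lemma abs_end_sub_le (hS : SmallRange a b c₀ c₁) {r ψ σ c c' m m' : ℝ} (hr : NearOne a b c₀ r)
    (hσ : |σ| = 1) (hc : c ∈ Icc c₀ c₁) (hc' : c' ∈ Icc c₀ c₁) (h : c ≤ c')
    (hm : m = ψ + σ * offset r (halfStep a b c m))
    (hm' : m' = ψ + σ * offset r (halfStep a b c' m')) :
    |(m' - σ * halfStep a b c' m') - (m - σ * halfStep a b c m)| ≤ (c' - c) * b / 2 ∧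
      |m' - m| ≤ 8 * ((c' - c) * a) := by
  have i1 := hS.abs_offset_sub_sub_le hr (hS.halfStep_mem hc m) (hS.halfStep_mem hc' m')
  have i2 := hS.abs_offset_sub_le hr (hS.halfStep_mem hc m) (hS.halfStep_mem hc' m')
  have i3 := hS.abs_halfStep_sub_le hc' m' m
  have i4 := hS.halfStep_sub_le hc hc' h m
  have i5 : |halfStep a b c' m' - halfStep a b c m| ≤ |halfStep a b c' m' - halfStep a b c' m| +
      |halfStep a b c' m - halfStep a b c m| := abs_sub_le _ _ _
  have e1 : |m' - m| = |offset r (halfStep a b c' m') - offset r (halfStep a b c m)| := by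
    have : m' - m = σ * (offset r (halfStep a b c' m') - offset r (halfStep a b c m)) := by
      linear_combination hm' - hm
    rw [this, abs_mul, hσ, one_mul]
  have e2 : |(m' - σ * halfStep a b c' m') - (m - σ * halfStep a b c m)| =
      |(offset r (halfStep a b c' m') - halfStep a b c' m') -
        (offset r (halfStep a b c m) - halfStep a b c m)| := by
    have : (m' - σ * halfStep a b c' m') - (m - σ * halfStep a b c m) =
        σ * ((offset r (halfStep a b c' m') - halfStep a b c' m') -
        (offset r (halfStep a b c m) - halfStep a b c m)) := by
      linear_combination hm' - hm
    rw [this, abs_mul, hσ, one_mul]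
  -- The half-angle changes by at most `1/4` of the change of `m` plus `2 * (c' - c) * a`, and `m`
  -- by at most twice the change of the half-angle. Half of the left side is thus absorbed.
  have i6 : |halfStep a b c' m' - halfStep a b c m| ≤ 4 * ((c' - c) * a) := by linarith
  refine ⟨?_, by linarith⟩
  rw [e2]
  refine i1.trans ?_
  have ha := hS.a_pos
  have hb := hS.b_pos
  calc b / (8 * a) * |halfStep a b c' m' - halfStep a b c m|
      ≤ b / (8 * a) * (4 * ((c' - c) * a)) := by gcongr
    _ = (c' - c) * b / 2 := by field_simp; ring

/-- The twist property: a larger Joachimsthal constant moves the end of a chord forward. -/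
lemma le_end_sub (hS : SmallRange a b c₀ c₁) {c c' m m' : ℝ} (hc : c ∈ Icc c₀ c₁)
    (hc' : c' ∈ Icc c₀ c₁) (h : c ≤ c')
    (hd : -((c' - c) * b) < (m' - halfStep a b c' m') - (m - halfStep a b c m)) :
    (c' - c) * b ≤ (m' + halfStep a b c' m') - (m + halfStep a b c m) := by
  have i1 := hS.le_halfStep_sub hc hc' h m
  have i2 := abs_le.1 (hS.abs_halfStep_sub_le hc' m' m)
  -- If the mean angle did not advance, the start would retreat by at least `(c' - c) * b`, against
  -- `hd`.
  rcases le_or_gt m' m with hm | hm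
  · rw [abs_of_nonpos (by linarith)] at i2
    exfalso
    linarith
  · rw [abs_of_pos (by linarith)] at i2
    linarith

end SmallRange

namespace SmallRange

variable {a b c₀ c₁ : ℝ}

lemma connects_le_of_lt (hS : SmallRange a b c₀ c₁) {r ψ r' ψ' c c' : ℝ} {j : ℕ}
    {first last : LinkType} {m m' : ℕ → ℝ} (hr : NearOne a b c₀ r) (hr' : NearOne a b c₀ r')
    (hj : 2 ≤ j) (hm : Connects a b c₀ c₁ r ψ r' ψ' j first last c m)
    (hm' : Connects a b c₀ c₁ r ψ r' ψ' j first last c' m') : c' ≤ c := by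
  by_contra! h
  have hκ : 0 < (c' - c) * b := mul_pos (sub_pos.2 h) hS.b_pos
  have hstart := abs_le.1
    (hS.abs_end_sub_le hr first.abs_sign hm.mem hm'.mem h.le hm.start hm'.start).1
  -- The opposite sign appears because the last chord is read backwards from `y`.
  have hend := abs_le.1 (hS.abs_end_sub_le hr' (ψ := ψ' + 2 * π) (σ := -last.sign)
    (by rw [abs_neg, last.abs_sign]) hm.mem hm'.mem h.le (hm.finish.trans (by ring))
    (hm'.finish.trans (by ring))).1
  -- The weak bound suffices to start the induction; one application of the twist upgrades it to the
  -- strong bound, which then persists.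
  have key : ∀ k ≤ j, -((c' - c) * b) <
      (m' k + halfStep a b c' (m' k)) - (m k + halfStep a b c (m k)) ∧
      (0 < k → (c' - c) * b ≤
        (m' k + halfStep a b c' (m' k)) - (m k + halfStep a b c (m k))) := by
    intro k
    induction k with
    | zero =>
      intro _
      refine ⟨?_, fun h => absurd h (lt_irrefl _)⟩
      -- For `T` the controlled end is the start of the first chord and the twist is applied; for
      -- `N` it is already the end.
      cases first with
      | T =>
        simp only [LinkType.sign, one_mul] at hstart
        linarith [hS.le_end_sub hm.mem hm'.mem h.le (m := m 0) (m' := m' 0) (by linarith)]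
      | N =>
        simp only [LinkType.sign] at hstart
        linarith
    | succ k ih =>
      intro hk
      have h1 := (ih (by omega)).1
      have := hS.le_end_sub hm.mem hm'.mem h.le (m := m (k + 1)) (m' := m' (k + 1))
        (by rw [hm.step k (by omega), hm'.step k (by omega)]; exact h1)
      exact ⟨by linarith, fun _ => this⟩
  cases last with
  | T =>
    simp only [LinkType.sign] at hend
    linarith [(key j le_rfl).2 (by omega)]
  -- Here the start of the last chord is controlled, which is the end of chord `j - 1`. The strong
  -- bound there needs `0 < j - 1`, hence `2 ≤ j`.
  | N =>
    simp only [LinkType.sign] at hend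
    obtain ⟨i, rfl⟩ : ∃ i, j = i + 1 := ⟨j - 1, by omega⟩
    have := (key i (by omega)).2 (by omega)
    rw [← hm.step i (by omega), ← hm'.step i (by omega)] at this
    linarith

/-- There is at most one orbit with given types of the first and the last link. -/
lemma connects_unique (hS : SmallRange a b c₀ c₁) {r ψ r' ψ' c c' : ℝ} {j : ℕ}
    {first last : LinkType} {m m' : ℕ → ℝ} (hr : NearOne a b c₀ r) (hr' : NearOne a b c₀ r')
    (hj : 2 ≤ j) (hm : Connects a b c₀ c₁ r ψ r' ψ' j first last c m)
    (hm' : Connects a b c₀ c₁ r ψ r' ψ' j first last c' m') :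
    c = c' ∧ ∀ k ≤ j, m k = m' k := by
  have hc : c = c' := le_antisymm (hS.connects_le_of_lt hr hr' hj hm' hm)
    (hS.connects_le_of_lt hr hr' hj hm hm')
  subst hc
  refine ⟨rfl, fun k => ?_⟩
  induction k with
  | zero =>
    intro _
    have h := (hS.abs_end_sub_le hr first.abs_sign hm.mem hm'.mem le_rfl hm.start hm'.start).2
    rw [sub_self, zero_mul, mul_zero, abs_nonpos_iff] at h
    linarith
  | succ k ih =>
    intro hk
    have h1 := hm.step k (by omega)
    have h2 := hm'.step k (by omega)
    rw [ih (by omega)] at h1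
    have h3 := hS.abs_halfStep_sub_le hm.mem (m (k + 1)) (m' (k + 1))
    rw [show halfStep a b c (m (k + 1)) - halfStep a b c (m' (k + 1)) = m (k + 1) - m' (k + 1) by
      linarith] at h3
    have : |m (k + 1) - m' (k + 1)| ≤ 0 := by linarith [abs_nonneg (m (k + 1) - m' (k + 1))]
    rw [abs_nonpos_iff] at this
    linarith

end SmallRange

/-! ### Existence by contraction and the intermediate value theorem. -/

/-- The fixed point of a contraction of the line depends continuously on parameters. -/
lemma exists_continuous_fixedPoint {X : Type*} [TopologicalSpace X] (F : X → ℝ → ℝ)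
    (hF : ∀ u, Continuous fun x => F x u) (hL : ∀ x u v, |F x u - F x v| ≤ 1 / 2 * |u - v|) :
    ∃ μ : C(X, ℝ), ∀ x, μ x = F x (μ x) := by
  have hfix : ∀ x, ∃ u, u = F x u := by
    intro x
    have hc : ContractingWith (1 / 2) (F x) := by
      refine ⟨by rw [← NNReal.coe_lt_coe]; norm_num, LipschitzWith.of_dist_le_mul fun u v => ?_⟩
      simpa [Real.dist_eq] using hL x u v
    exact ⟨_, hc.fixedPoint_isFixedPt.symm⟩
  choose μ hμ using hfix
  refine ⟨⟨μ, continuous_iff_continuousAt.2 fun x₀ => ?_⟩, hμ⟩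
  have hlim : Tendsto (fun x => 2 * |F x (μ x₀) - F x₀ (μ x₀)|) (𝓝 x₀) (𝓝 0) := by
    have h1 : Tendsto (fun x => F x (μ x₀)) (𝓝 x₀) (𝓝 (F x₀ (μ x₀))) := (hF (μ x₀)).tendsto x₀
    simpa using ((h1.sub_const (F x₀ (μ x₀))).abs.const_mul 2)
  refine tendsto_iff_dist_tendsto_zero.2 (squeeze_zero (fun _ => dist_nonneg) (fun x => ?_) hlim)
  rw [Real.dist_eq]
  have h1 : |μ x - μ x₀| ≤ |F x (μ x) - F x (μ x₀)| + |F x (μ x₀) - F x₀ (μ x₀)| := by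
    conv_lhs => rw [hμ x, hμ x₀]
    exact abs_sub_le _ _ _
  linarith [hL x (μ x) (μ x₀)]

namespace SmallRange

variable {a b c₀ c₁ : ℝ}

lemma abs_sign_mul_offset_le (hS : SmallRange a b c₀ c₁) {r c : ℝ} (hr : NearOne a b c₀ r)
    (hc : c ∈ Icc c₀ c₁) (t : LinkType) (m : ℝ) :
    |t.sign * offset r (halfStep a b c m)| ≤ 1 / 10 := by
  rw [abs_mul, t.abs_sign, one_mul, abs_of_nonneg (offset_nonneg _ _)]
  exact (hS.offset_le hr (hS.halfStep_mem hc m)).trans (hS.halfStep_le hc m)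

/-- There is an orbit with given types of the first and the last link. -/
lemma exists_connects (hS : SmallRange a b c₀ c₁) {r ψ r' ψ' : ℝ} {j : ℕ}
    (hr : NearOne a b c₀ r) (hr' : NearOne a b c₀ r') (hψ : |ψ' - ψ| ≤ 1)
    (hlow : 4 * j * (c₀ * a) ≤ 2) (hup : 20 ≤ 2 * j * (c₁ * b)) (first last : LinkType) :
    ∃ c m, Connects a b c₀ c₁ r ψ r' ψ' j first last c m := by
  have hcont : ∀ u, Continuous fun x : Icc c₀ c₁ => halfStep a b x u := fun u =>
    (continuous_halfStep a b).comp (by fun_prop : Continuous fun x : Icc c₀ c₁ => ((x : ℝ), u))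
  -- The mean angle of the first chord is only given implicitly, since its half-angle depends on it;
  -- the same holds for each following chord.
  obtain ⟨μ, hμ⟩ := exists_continuous_fixedPoint
    (fun (x : Icc c₀ c₁) u => ψ + first.sign * offset r (halfStep a b x u))
    (fun u => continuous_const.add (continuous_const.mul ((continuous_offset r).comp (hcont u))))
    (fun x u v => by
      have h1 := hS.abs_offset_sub_le hr (hS.halfStep_mem x.2 v) (hS.halfStep_mem x.2 u)
      have h2 := hS.abs_halfStep_sub_le x.2 u v
      rw [add_sub_add_left_eq_sub, ← mul_sub, abs_mul, first.abs_sign, one_mul]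
      linarith)
  have hnext : ∀ p : C(Icc c₀ c₁, ℝ), ∃ p' : C(Icc c₀ c₁, ℝ), ∀ x,
      p' x = p x + halfStep a b x (p x) + halfStep a b x (p' x) := fun p => by
    refine exists_continuous_fixedPoint
      (fun (x : Icc c₀ c₁) u => p x + halfStep a b x (p x) + halfStep a b x u)
      (fun u => (p.continuous.add ((continuous_halfStep a b).comp
        (continuous_subtype_val.prodMk p.continuous))).add (hcont u)) (fun x u v => ?_)
    have h2 := hS.abs_halfStep_sub_le x.2 u v
    rw [add_sub_add_left_eq_sub]
    linarith [abs_nonneg (u - v)]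
  choose next hnext using hnext
  let M : ℕ → C(Icc c₀ c₁, ℝ) := fun k => Nat.rec μ (fun _ p => next p) k
  have hM : ∀ k x, M (k + 1) x = M k x + halfStep a b x (M k x) + halfStep a b x (M (k + 1) x) :=
    fun k x => hnext (M k) x
  have hbd : ∀ (k : ℕ) (x : Icc c₀ c₁), 2 * k * ((x : ℝ) * b) ≤ M k x - M 0 x ∧
      M k x - M 0 x ≤ 4 * k * ((x : ℝ) * a) := by
    intro k x
    induction k with
    | zero => simp
    | succ k ih =>
      have h1 := hM k x
      have := hS.mul_b_le_halfStep x.2 (M k x)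
      have := hS.mul_b_le_halfStep x.2 (M (k + 1) x)
      have := hS.halfStep_le_two_mul x.2 (M k x)
      have := hS.halfStep_le_two_mul x.2 (M (k + 1) x)
      push_cast
      constructor <;> nlinarith
  -- The signed error at `y`. The advance `M j - M 0` is at most `2` for `c₀` and at least `20` for
  -- `c₁`, so `E` changes sign despite the offsets and `|ψ' - ψ| ≤ 1`.
  let E : Icc c₀ c₁ → ℝ := fun x =>
    M j x + last.sign * offset r' (halfStep a b x (M j x)) - (ψ' + 2 * π)
  have hE : Continuous E := by
    refine ((M j).continuous.add (continuous_const.mul ((continuous_offset r').comp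
      ((continuous_halfStep a b).comp
        (continuous_subtype_val.prodMk (M j).continuous))))).sub continuous_const
  have h0 : ∀ x, |M 0 x - ψ| ≤ 1 / 10 := fun x => by
    have : M 0 x - ψ = first.sign * offset r (halfStep a b x (M 0 x)) := by
      have : M 0 x = ψ + first.sign * offset r (halfStep a b x (M 0 x)) := hμ x
      linarith
    rw [this]
    exact hS.abs_sign_mul_offset_le hr x.2 _ _
  have hψ := abs_le.1 hψ
  have : PreconnectedSpace (Icc c₀ c₁) := Subtype.preconnectedSpace isPreconnected_Icc
  obtain ⟨x, hx⟩ : ∃ x, E x = 0 := by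
    refine mem_range_of_exists_le_of_exists_ge hE ⟨⟨c₀, left_mem_Icc.2 hS.lower_le⟩, ?_⟩
      ⟨⟨c₁, right_mem_Icc.2 hS.lower_le⟩, ?_⟩
    · have h1 := (hbd j ⟨c₀, left_mem_Icc.2 hS.lower_le⟩).2
      have h2 := abs_le.1 (h0 ⟨c₀, left_mem_Icc.2 hS.lower_le⟩)
      have h3 := abs_le.1 (hS.abs_sign_mul_offset_le hr' (left_mem_Icc.2 hS.lower_le) last
        (M j ⟨c₀, left_mem_Icc.2 hS.lower_le⟩))
      change M j _ + _ - _ ≤ 0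
      linarith [pi_gt_three]
    · have h1 := (hbd j ⟨c₁, right_mem_Icc.2 hS.lower_le⟩).1
      have h2 := abs_le.1 (h0 ⟨c₁, right_mem_Icc.2 hS.lower_le⟩)
      have h3 := abs_le.1 (hS.abs_sign_mul_offset_le hr' (right_mem_Icc.2 hS.lower_le) last
        (M j ⟨c₁, right_mem_Icc.2 hS.lower_le⟩))
      change 0 ≤ M j _ + _ - _
      linarith [pi_le_four]
  refine ⟨x, fun k => M k x, x.2, fun k _ => ?_, hμ x, ?_⟩
  · have := hM k x
    linarith
  · change M j x + _ - _ = 0 at hx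
    linarith

end SmallRange

/-! ### Chords in coordinates and the reflection law. -/

/-- The point with parameter `t` on the chord with mean angle `m` and half-angle `h`. -/
def linePoint (a b m h t : ℝ) : Plane :=
  !₂[a * (cos h * cos m - t * sin m), b * (cos h * sin m + t * cos m)]

/-- The unit vector in the direction of the counterclockwise chords with mean angle `m`. -/
def chordDirection (a b m : ℝ) : Plane := (speed a b m)⁻¹ • !₂[-(a * sin m), b * cos m]

lemma plane_ext {p q : Plane} (h0 : p 0 = q 0) (h1 : p 1 = q 1) : p = q := by
  ext i; fin_cases i
  · exact h0
  · exact h1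

lemma inner_plane (u v : Plane) : inner ℝ u v = u 0 * v 0 + u 1 * v 1 := by
  simp [PiLp.inner_apply, Fin.sum_univ_two, mul_comm]

@[simp] lemma boundaryPoint_zero (a b φ : ℝ) : boundaryPoint a b φ 0 = a * cos φ := rfl
@[simp] lemma boundaryPoint_one (a b φ : ℝ) : boundaryPoint a b φ 1 = b * sin φ := rfl
@[simp] lemma linePoint_zero (a b m h t : ℝ) :
    linePoint a b m h t 0 = a * (cos h * cos m - t * sin m) := rfl
@[simp] lemma linePoint_one (a b m h t : ℝ) :
    linePoint a b m h t 1 = b * (cos h * sin m + t * cos m) := rfl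
@[simp] lemma outwardNormal_zero (a b : ℝ) (p : Plane) : outwardNormal a b p 0 = p 0 / a ^ 2 := rfl
@[simp] lemma outwardNormal_one (a b : ℝ) (p : Plane) : outwardNormal a b p 1 = p 1 / b ^ 2 := rfl
@[simp] lemma chordDirection_zero (a b m : ℝ) :
    chordDirection a b m 0 = (speed a b m)⁻¹ * -(a * sin m) := rfl
@[simp] lemma chordDirection_one (a b m : ℝ) :
    chordDirection a b m 1 = (speed a b m)⁻¹ * (b * cos m) := rfl

lemma boundaryPoint_sub (a b m h : ℝ) :
    boundaryPoint a b (m - h) = linePoint a b m h (-sin h) := by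
  apply plane_ext
  · simp [cos_sub]; left; ring
  · simp [sin_sub]; left; ring

lemma boundaryPoint_add (a b m h : ℝ) :
    boundaryPoint a b (m + h) = linePoint a b m h (sin h) := by
  apply plane_ext
  · simp [cos_add]; left; ring
  · simp [sin_add]; left; ring

lemma lineMap_linePoint (a b m h s t r : ℝ) :
    AffineMap.lineMap (linePoint a b m h s) (linePoint a b m h t) r =
      linePoint a b m h (s + r * (t - s)) := by
  apply plane_ext
  · simp [AffineMap.lineMap_apply]; ring
  · simp [AffineMap.lineMap_apply]; ring

lemma linePoint_sub (a b m h s t : ℝ) :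
    linePoint a b m h t - linePoint a b m h s = (t - s) • !₂[-(a * sin m), b * cos m] := by
  apply plane_ext
  · simp; ring
  · simp; ring

lemma norm_chord (a b m : ℝ) : ‖(!₂[-(a * sin m), b * cos m] : Plane)‖ = speed a b m := by
  rw [EuclideanSpace.norm_eq, Fin.sum_univ_two, speed]
  congr 1
  simp [mul_pow]

lemma direction_linePoint (a b m h : ℝ) {s t : ℝ} (hst : s < t) :
    direction (linePoint a b m h s) (linePoint a b m h t) = chordDirection a b m := by
  have : 0 < t - s := sub_pos.2 hst
  rw [direction, linePoint_sub, norm_smul, norm_chord, norm_of_nonneg this.le, smul_smul,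
    chordDirection]
  congr 1
  field_simp

lemma linePoint_ne {a b : ℝ} (hb : 0 < b) (hab : b ≤ a) (m h : ℝ) {s t : ℝ} (hst : s < t) :
    linePoint a b m h s ≠ linePoint a b m h t := by
  intro h1
  have h2 := linePoint_sub a b m h s t
  rw [h1, sub_self] at h2
  have h3 := congrArg norm h2
  rw [norm_smul, norm_chord, norm_of_nonneg (sub_pos.2 hst).le, norm_zero] at h3
  have := mul_pos (sub_pos.2 hst) (speed_pos hb hab m)
  linarith

lemma linePoint_sq_add_sq {a b : ℝ} (hb : 0 < b) (hab : b ≤ a) (m h t : ℝ) :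
    linePoint a b m h t 0 ^ 2 / a ^ 2 + linePoint a b m h t 1 ^ 2 / b ^ 2 = cos h ^ 2 + t ^ 2 := by
  have ha := (hb.trans_le hab).ne'
  have hb := hb.ne'
  simp only [linePoint_zero, linePoint_one, mul_pow]
  rw [mul_div_cancel_left₀ _ (pow_ne_zero 2 ha), mul_div_cancel_left₀ _ (pow_ne_zero 2 hb)]
  linear_combination (cos h ^ 2 + t ^ 2) * sin_sq_add_cos_sq m

lemma boundaryPoint_mem {a b : ℝ} (hb : 0 < b) (hab : b ≤ a) (φ : ℝ) :
    boundaryPoint a b φ ∈ ellipseBoundary a b := by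
  have h := linePoint_sq_add_sq hb hab φ 0 (sin 0)
  rw [← boundaryPoint_add, add_zero, sin_zero, cos_zero] at h
  exact h.trans (by norm_num)

/-- A vector is the reflection of another one exactly if the normal components are opposite and the
tangential components are equal. -/
lemma eq_reflectAcross_iff {n v w : Plane} (hn : n 0 ^ 2 + n 1 ^ 2 ≠ 0) :
    w = reflectAcross n v ↔ w 0 * n 0 + w 1 * n 1 = -(v 0 * n 0 + v 1 * n 1) ∧
      w 1 * n 0 - w 0 * n 1 = v 1 * n 0 - v 0 * n 1 := by
  have hn' : n 0 * n 0 + n 1 * n 1 ≠ 0 := by simpa [sq] using hn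
  have e : ∀ i, reflectAcross n v i =
      v i - 2 * (v 0 * n 0 + v 1 * n 1) / (n 0 * n 0 + n 1 * n 1) * n i := by
    intro i
    rw [reflectAcross, inner_plane, inner_plane]
    rfl
  constructor
  · intro h
    have h0 := (congrArg (fun p : Plane => p 0) h).trans (e 0)
    have h1 := (congrArg (fun p : Plane => p 1) h).trans (e 1)
    simp only at h0 h1
    rw [h0, h1]
    constructor <;> (field_simp; ring)
  · rintro ⟨h1, h2⟩
    apply plane_ext
    · rw [e 0]
      field_simp
      linear_combination n 0 * h1 - n 1 * h2
    · rw [e 1]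
      field_simp
      linear_combination n 1 * h1 + n 0 * h2

/-- A multiple of the tangential component, at the angle `ω`, of the chord with mean angle `m`. -/
def tangential (a b m ω : ℝ) : ℝ := a ^ 2 * (sin m * sin ω) + b ^ 2 * (cos m * cos ω)

/-- Lagrange's identity for `(a * sin m, b * cos m)` and `(a * sin ω, b * cos ω)`. It recovers the
tangential component from the normal one, up to sign. -/
lemma tangential_sq {a b : ℝ} (hb : 0 < b) (hab : b ≤ a) (m ω : ℝ) :
    a ^ 2 * b ^ 2 * sin (ω - m) ^ 2 + tangential a b m ω ^ 2 =
      speed a b m ^ 2 * speed a b ω ^ 2 := by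
  rw [speed_sq hb hab, speed_sq hb hab, sin_sub, tangential]
  ring

/-- The reflection law in terms of the mean angles of two successive chords. -/
lemma chordDirection_eq_reflectAcross_iff {a b : ℝ} (hb : 0 < b) (hab : b ≤ a) (m m' ω : ℝ) :
    chordDirection a b m' =
        reflectAcross (outwardNormal a b (boundaryPoint a b ω)) (chordDirection a b m) ↔
      sin (ω - m) / speed a b m = sin (m' - ω) / speed a b m' ∧
      tangential a b m ω / speed a b m = tangential a b m' ω / speed a b m' := by
  have ha := (hb.trans_le hab)
  have s1 := speed_pos hb hab m
  have s2 := speed_pos hb hab m'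
  rw [eq_reflectAcross_iff]
  · simp only [chordDirection_zero, chordDirection_one, outwardNormal_zero, outwardNormal_one,
      boundaryPoint_zero, boundaryPoint_one]
    have e1 : ∀ k, (speed a b k)⁻¹ * -(a * sin k) * (a * cos ω / a ^ 2) +
        (speed a b k)⁻¹ * (b * cos k) * (b * sin ω / b ^ 2) = sin (ω - k) / speed a b k := by
      intro k
      have := speed_pos hb hab k
      rw [sin_sub]
      field_simp
      ring
    have e2 : ∀ k, (speed a b k)⁻¹ * (b * cos k) * (a * cos ω / a ^ 2) -
        (speed a b k)⁻¹ * -(a * sin k) * (b * sin ω / b ^ 2) =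
          tangential a b k ω / speed a b k / (a * b) := by
      intro k
      have := speed_pos hb hab k
      rw [tangential]
      field_simp
      ring
    rw [e1, e1, e2, e2, div_left_inj' (mul_pos ha hb).ne', ← neg_sub m' ω, sin_neg, neg_div,
      neg_inj]
    exact and_congr eq_comm eq_comm
  · simp only [outwardNormal_zero, outwardNormal_one, boundaryPoint_zero, boundaryPoint_one]
    have : (a * cos ω / a ^ 2) ^ 2 + (b * sin ω / b ^ 2) ^ 2 =
        speed a b ω ^ 2 / (a ^ 2 * b ^ 2) := by
      rw [speed_sq hb hab]
      field_simp
      ring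
    rw [this]
    have := speed_pos hb hab ω
    positivity

lemma tangential_eq (a b m ω : ℝ) : 2 * tangential a b m ω =
    (a ^ 2 + b ^ 2) * cos (ω - m) - (a ^ 2 - b ^ 2) * cos (ω + m) := by
  rw [cos_add, cos_sub, tangential]; ring

/-- A short or nearly full chord has the obvious sense. -/
lemma tangential_sign {a b w : ℝ} (hb : 0 < b) (hab : b ≤ a)
    (hw : ((a ^ 2 - b ^ 2) / (a ^ 2 + b ^ 2)) ^ 2 + w ^ 2 < 1) {m ω : ℝ}
    (hs : sin (ω - m) ^ 2 ≤ w ^ 2) :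
    (0 < tangential a b m ω ↔ 0 < cos (ω - m)) := by
  have h1 := tangential_eq a b m ω
  have ha := hb.trans_le hab
  have hsq : b ^ 2 ≤ a ^ 2 := by gcongr
  have hp : 0 < a ^ 2 + b ^ 2 := by positivity
  -- In `tangential_eq` the second term is at most `a ^ 2 - b ^ 2` in size, so under this bound the
  -- first term decides the sign.
  have h2 : ((a ^ 2 - b ^ 2) / (a ^ 2 + b ^ 2)) ^ 2 < cos (ω - m) ^ 2 := by
    nlinarith [sin_sq_add_cos_sq (ω - m)]
  have h3 := sq_lt_sq.1 h2
  rw [abs_of_nonneg (by apply div_nonneg <;> linarith), div_lt_iff₀ hp] at h3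
  have h4 := abs_le.1 (abs_cos_le_one (ω + m))
  have h5 : (a ^ 2 - b ^ 2) * cos (ω + m) ≤ a ^ 2 - b ^ 2 := by nlinarith
  have h6 : -(a ^ 2 - b ^ 2) ≤ (a ^ 2 - b ^ 2) * cos (ω + m) := by nlinarith
  constructor
  · intro h
    by_contra! h'
    rw [abs_of_nonpos h'] at h3
    linarith
  · intro h
    rw [abs_of_pos h] at h3
    linarith

/-! ### Tangency to confocal ellipses. -/

/-- The position on a chord of the point of tangency to a confocal ellipse. -/
def tangencyParameter (a b c m h : ℝ) : ℝ := -(c ^ 2 * (a ^ 2 - b ^ 2) * (sin m * cos m)) / cos h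

/-- At a point of tangency the relative gradient of the confocal ellipse is orthogonal to `(-sin m,
cos m)`, hence a multiple of `(cos m, sin m)`. This forces `lam = a * b * c` and the position on the
line; conversely these values give a tangency. -/
lemma linkIsTangent_linePoint_iff {a b : ℝ} (hb : 0 < b) (hab : b ≤ a) {c m h s t : ℝ}
    (hc : 0 < c) (hca : c * a < 1) (hh : 0 < cos h) (hs : sin h = c * speed a b m) (hst : s < t) :
    LinkIsTangent a b (linePoint a b m h s) (linePoint a b m h t) ↔
      tangencyParameter a b c m h ∈ Icc s t := by
  have ha := hb.trans_le hab
  have hsp := speed_pos hb hab m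
  have hsq := speed_sq hb hab m
  have hm := sin_sq_add_cos_sq m
  have hC2 : cos h ^ 2 = 1 - c ^ 2 * (a ^ 2 * sin m ^ 2 + b ^ 2 * cos m ^ 2) := by
    rw [cos_sq', hs, mul_pow, hsq]
  have hcb : c * b < 1 := lt_of_le_of_lt (by gcongr) hca
  constructor
  · rintro ⟨z, hz, lam, hl0, hl1, hz1, hz2⟩
    rw [segment_eq_image_lineMap] at hz
    obtain ⟨θ, hθ, rfl⟩ := hz
    rw [lineMap_linePoint] at hz1 hz2
    have hu : s + θ * (t - s) ∈ Icc s t := by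
      constructor
      · nlinarith [hθ.1, hθ.2]
      · nlinarith [hθ.1, hθ.2]
    set u := s + θ * (t - s)
    suffices u = tangencyParameter a b c m h by rwa [← this]
    have hA : 0 < a ^ 2 - lam ^ 2 := by nlinarith
    have hB : 0 < b ^ 2 - lam ^ 2 := by nlinarith
    rw [linePoint_sub] at hz2
    change linePoint a b m h u 0 ^ 2 / (a ^ 2 - lam ^ 2) +
      linePoint a b m h u 1 ^ 2 / (b ^ 2 - lam ^ 2) = 1 at hz1
    simp only [linePoint_zero, linePoint_one] at hz1 hz2
    simp only [PiLp.smul_apply, smul_eq_mul, Matrix.cons_val_zero, Matrix.cons_val_one,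
      Matrix.cons_val_fin_one] at hz2
    have hts : t - s ≠ 0 := (sub_pos.2 hst).ne'
    set Z := cos h * cos m - u * sin m with hZ
    set W := cos h * sin m + u * cos m with hW
    -- `(V₀, V₁)` is half the gradient in relative coordinates, normalized to pair to `1` with the
    -- point `(Z, W)`.
    obtain ⟨V₀, hV₀⟩ : ∃ V₀, V₀ = a ^ 2 * Z / (a ^ 2 - lam ^ 2) := ⟨_, rfl⟩
    obtain ⟨V₁, hV₁⟩ : ∃ V₁, V₁ = b ^ 2 * W / (b ^ 2 - lam ^ 2) := ⟨_, rfl⟩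
    have g1 : V₀ * Z + V₁ * W = 1 := by rw [← hz1, hV₀, hV₁]; ring
    have g2 : V₁ * cos m - V₀ * sin m = 0 := by
      apply mul_left_cancel₀ hts
      rw [mul_zero, ← hz2, hV₀, hV₁]; ring
    have g3 : (a ^ 2 - lam ^ 2) * V₀ = a ^ 2 * Z := by rw [hV₀]; field_simp
    have g4 : (b ^ 2 - lam ^ 2) * V₁ = b ^ 2 * W := by rw [hV₁]; field_simp
    obtain ⟨μ, hμ⟩ : ∃ μ, μ = V₀ * cos m + V₁ * sin m := ⟨_, rfl⟩
    have g5 : V₀ = μ * cos m := by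
      rw [hμ]; linear_combination -V₀ * hm - sin m * g2
    have g6 : V₁ = μ * sin m := by
      rw [hμ]; linear_combination -V₁ * hm + cos m * g2
    have gZ : Z * cos m + W * sin m = cos h := by
      rw [hZ, hW]; linear_combination cos h * hm
    have gu : W * cos m - Z * sin m = u := by
      rw [hZ, hW]; linear_combination u * hm
    have g7 : μ * cos h = 1 := by
      rw [← g1, g5, g6, ← gZ]; ring
    rw [g5] at g3
    rw [g6] at g4
    have g8 : a ^ 2 * b ^ 2 * cos h = μ * (a ^ 2 * b ^ 2 -
        lam ^ 2 * (a ^ 2 * sin m ^ 2 + b ^ 2 * cos m ^ 2)) := by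
      rw [← gZ]
      linear_combination -b ^ 2 * cos m * g3 - a ^ 2 * sin m * g4 + μ * a ^ 2 * b ^ 2 * hm
    have g9 : a ^ 2 * b ^ 2 * u = -(μ * lam ^ 2 * (a ^ 2 - b ^ 2) * (sin m * cos m)) := by
      rw [← gu]
      linear_combination -a ^ 2 * cos m * g4 + b ^ 2 * sin m * g3
    have g10 : lam ^ 2 = a ^ 2 * b ^ 2 * c ^ 2 := by
      have h1 : speed a b m ^ 2 * lam ^ 2 = speed a b m ^ 2 * (a ^ 2 * b ^ 2 * c ^ 2) := by
        rw [hsq]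
        linear_combination cos h * g8 - a ^ 2 * b ^ 2 * hC2 + (a ^ 2 * b ^ 2 -
          lam ^ 2 * (a ^ 2 * sin m ^ 2 + b ^ 2 * cos m ^ 2)) * g7
      exact mul_left_cancel₀ (by positivity) h1
    rw [tangencyParameter, eq_div_iff hh.ne']
    apply mul_left_cancel₀ (by positivity : a ^ 2 * b ^ 2 ≠ 0)
    rw [g10] at g9
    linear_combination cos h * g9 -
      (a ^ 2 * b ^ 2 * c ^ 2 * (a ^ 2 - b ^ 2) * (sin m * cos m)) * g7
  · intro hu
    set u := tangencyParameter a b c m h with hud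
    have hu' : u * cos h = -(c ^ 2 * (a ^ 2 - b ^ 2) * (sin m * cos m)) := by
      rw [hud, tangencyParameter, div_mul_cancel₀ _ hh.ne']
    have hA : 0 < 1 - (c * b) ^ 2 := by nlinarith [mul_pos hc hb]
    have hB : 0 < 1 - (c * a) ^ 2 := by nlinarith [mul_pos hc ha]
    have eA : a ^ 2 - (a * b * c) ^ 2 = a ^ 2 * (1 - (c * b) ^ 2) := by ring
    have eB : b ^ 2 - (a * b * c) ^ 2 = b ^ 2 * (1 - (c * a) ^ 2) := by ring
    have hZ : cos h * cos m - u * sin m = (1 - (c * b) ^ 2) * cos m / cos h := by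
      rw [eq_div_iff hh.ne']
      linear_combination cos m * hC2 - sin m * hu' - c ^ 2 * b ^ 2 * cos m * hm
    have hW : cos h * sin m + u * cos m = (1 - (c * a) ^ 2) * sin m / cos h := by
      rw [eq_div_iff hh.ne']
      linear_combination sin m * hC2 + cos m * hu' - c ^ 2 * a ^ 2 * sin m * hm
    have hC2' : cos h ^ 2 = (1 - (c * b) ^ 2) * cos m ^ 2 + (1 - (c * a) ^ 2) * sin m ^ 2 := by
      linear_combination hC2 - hm
    refine ⟨linePoint a b m h u, ?_, a * b * c, by positivity, ?_, ?_, ?_⟩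
    · rw [segment_eq_image_lineMap]
      have hts : 0 < t - s := sub_pos.2 hst
      refine ⟨(u - s) / (t - s), ⟨div_nonneg (by linarith [hu.1]) hts.le,
        (div_le_one hts).2 (by linarith [hu.2])⟩, ?_⟩
      rw [lineMap_linePoint, div_mul_cancel₀ _ hts.ne']
      congr 1; ring
    · nlinarith
    · change linePoint a b m h u 0 ^ 2 / (a ^ 2 - (a * b * c) ^ 2) +
        linePoint a b m h u 1 ^ 2 / (b ^ 2 - (a * b * c) ^ 2) = 1
      rw [linePoint_zero, linePoint_one, hZ, hW, eA, eB]
      generalize 1 - (c * b) ^ 2 = A at hA hC2' ⊢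
      generalize 1 - (c * a) ^ 2 = B at hB hC2' ⊢
      field_simp
      linear_combination -hC2'
    · rw [linePoint_sub, linePoint_zero, linePoint_one, hZ, hW, eA, eB]
      simp only [PiLp.smul_apply, smul_eq_mul, Matrix.cons_val_zero, Matrix.cons_val_one,
        Matrix.cons_val_fin_one]
      generalize 1 - (c * b) ^ 2 = A at hA ⊢
      generalize 1 - (c * a) ^ 2 = B at hB ⊢
      field_simp
      ring

/-! ### Broken geodesics as sequences of chords. -/

/-- The chords with mean angles `m 0, …, m j` and half-angles `h 0, …, h j` are successive, `x` lies
on the first and `y` on the last one. -/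
structure IsChordPath (a b : ℝ) (x y : Plane) (j : ℕ) (m h : ℕ → ℝ) : Prop where
  half_mem : ∀ k ≤ j, h k ∈ Ioo 0 π
  step : ∀ k < j, m (k + 1) - h (k + 1) = m k + h k
  first : ∃ t ∈ Ioo (-sin (h 0)) (sin (h 0)), x = linePoint a b (m 0) (h 0) t
  last : ∃ t ∈ Ioo (-sin (h j)) (sin (h j)), y = linePoint a b (m j) (h j) t

/-- The chords of an elastically reflected chord path around the boundary, approximately once. -/
structure IsChordOrbit (a b : ℝ) (x y : Plane) (j : ℕ) (m h : ℕ → ℝ) : Prop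
    extends IsChordPath a b x y j m h where
  reflection : ∀ k < j, chordDirection a b (m (k + 1)) =
    reflectAcross (outwardNormal a b (boundaryPoint a b (m k + h k))) (chordDirection a b (m k))
  pi_le : π ≤ (m j + h j) - (m 0 + h 0)
  le_three_pi : (m j + h j) - (m 0 + h 0) ≤ 3 * π

/-- The points where a chord path is reflected. -/
def impactPoints (a b : ℝ) (j : ℕ) (m h : ℕ → ℝ) : Fin j → Plane :=
  fun k => boundaryPoint a b (m k + h k)

lemma vertex_impactPoints (a b : ℝ) {j : ℕ} (x y : Plane) (m h : ℕ → ℝ) {k : ℕ} (hk : k < j) :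
    vertex x y (impactPoints a b j m h) (k + 1) = boundaryPoint a b (m k + h k) := by
  simp [vertex, hk, impactPoints]

lemma vertex_last {j : ℕ} (x y : Plane) (q : Fin j → Plane) : vertex x y q (j + 1) = y := by
  simp [vertex]

namespace IsChordPath

variable {a b : ℝ} {x y : Plane} {j : ℕ} {m h : ℕ → ℝ}

lemma sin_pos (hp : IsChordPath a b x y j m h) {k : ℕ} (hk : k ≤ j) : 0 < sin (h k) :=
  sin_pos_of_mem_Ioo (hp.half_mem k hk)

lemma vertex_start (hp : IsChordPath a b x y j m h) {k : ℕ} (hk0 : 0 < k) (hk : k ≤ j) :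
    vertex x y (impactPoints a b j m h) k = linePoint a b (m k) (h k) (-sin (h k)) := by
  obtain ⟨i, rfl⟩ : ∃ i, k = i + 1 := ⟨k - 1, by omega⟩
  rw [vertex_impactPoints a b x y m h (by omega), ← hp.step i (by omega), boundaryPoint_sub]

lemma vertex_end (x y : Plane) (m h : ℕ → ℝ) {k : ℕ} (hk : k < j) :
    vertex x y (impactPoints a b j m h) (k + 1) = linePoint a b (m k) (h k) (sin (h k)) := by
  rw [vertex_impactPoints a b x y m h hk, boundaryPoint_add]

lemma exists_link (hp : IsChordPath a b x y j m h) (hj : 0 < j) {k : ℕ} (hk : k ≤ j) :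
    ∃ s t, s < t ∧ vertex x y (impactPoints a b j m h) k = linePoint a b (m k) (h k) s ∧
      vertex x y (impactPoints a b j m h) (k + 1) = linePoint a b (m k) (h k) t := by
  rcases Nat.eq_zero_or_pos k with rfl | hk0
  · obtain ⟨t, ht, hx⟩ := hp.first
    exact ⟨t, _, ht.2, hx, vertex_end x y m h hj⟩
  · rcases hk.lt_or_eq with hk' | rfl
    · exact ⟨_, _, by linarith [hp.sin_pos hk], hp.vertex_start hk0 hk, vertex_end x y m h hk'⟩
    · obtain ⟨t, ht, hy⟩ := hp.last
      exact ⟨_, t, ht.1, hp.vertex_start hk0 hk, by rw [vertex_last, hy]⟩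

lemma direction_vertex (hp : IsChordPath a b x y j m h) (hj : 0 < j) {k : ℕ} (hk : k ≤ j) :
    direction (vertex x y (impactPoints a b j m h) k)
      (vertex x y (impactPoints a b j m h) (k + 1)) = chordDirection a b (m k) := by
  obtain ⟨s, t, hst, h1, h2⟩ := hp.exists_link hj hk
  rw [h1, h2, direction_linePoint a b _ _ hst]

lemma isBrokenGeodesic_iff (hp : IsChordPath a b x y j m h) (hb : 0 < b) (hab : b ≤ a)
    (hj : 0 < j) :
    IsBrokenGeodesic a b x y (impactPoints a b j m h) ↔ ∀ k < j, chordDirection a b (m (k + 1)) =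
      reflectAcross (outwardNormal a b (boundaryPoint a b (m k + h k)))
        (chordDirection a b (m k)) := by
  constructor
  · intro hq k hk
    have := hq.reflection k hk
    rwa [hp.direction_vertex hj (by omega : k + 1 ≤ j), hp.direction_vertex hj hk.le,
      vertex_impactPoints a b x y m h hk] at this
  · intro hr
    refine ⟨fun k => boundaryPoint_mem hb hab _, fun k hk => ?_, fun k hk => ?_⟩
    · obtain ⟨s, t, hst, h1, h2⟩ := hp.exists_link hj hk
      rw [h1, h2]
      exact linePoint_ne hb hab _ _ hst
    · rw [hp.direction_vertex hj (by omega : k + 1 ≤ j), hp.direction_vertex hj hk.le,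
        vertex_impactPoints a b x y m h hk]
      exact hr k hk

/-- The continuation of the last link meets the boundary at the end of the last chord. -/
lemma isNextImpact (hp : IsChordPath a b x y j m h) (hb : 0 < b) (hab : b ≤ a) (hj : 0 < j) :
    IsNextImpact a b (vertex x y (impactPoints a b j m h) j) y
      (boundaryPoint a b (m j + h j)) := by
  obtain ⟨t, ht, hy⟩ := hp.last
  have hs := hp.sin_pos le_rfl
  have h1 : 0 < t - -sin (h j) := by linarith [ht.1]
  refine ⟨boundaryPoint_mem hb hab _, 2 * sin (h j) / (t - -sin (h j)), ?_, ?_⟩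
  · rw [lt_div_iff₀ h1]; linarith [ht.2]
  · rw [hp.vertex_start hj le_rfl, hy, lineMap_linePoint, boundaryPoint_add,
      div_mul_cancel₀ _ h1.ne']
    congr 1; ring

end IsChordPath

lemma exists_polar {u v : ℝ} (h : u ^ 2 + v ^ 2 ≠ 0) :
    ∃ r θ : ℝ, 0 < r ∧ u = r * cos θ ∧ v = r * sin θ := by
  refine ⟨‖(⟨u, v⟩ : ℂ)‖, Complex.arg ⟨u, v⟩, norm_pos_iff.2 ?_,
    (Complex.norm_mul_cos_arg ⟨u, v⟩).symm, (Complex.norm_mul_sin_arg ⟨u, v⟩).symm⟩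
  intro h0
  have h1 := congrArg Complex.re h0
  have h2 := congrArg Complex.im h0
  simp only [Complex.zero_re, Complex.zero_im] at h1 h2
  subst h1; subst h2
  simp at h

lemma exists_add_int_mul_two_pi_mem (θ : ℝ) : ∃ n : ℤ, θ + n * (2 * π) ∈ Ioc (-π) π := by
  obtain ⟨n, hn, -⟩ := existsUnique_add_zsmul_mem_Ioc two_pi_pos θ (-π)
  refine ⟨n, ?_⟩
  rw [zsmul_eq_mul] at hn
  exact ⟨hn.1, by linarith [hn.2]⟩

/-- The chord through an interior point that ends at a given boundary point. -/
lemma exists_chord_to {a b : ℝ} (hb : 0 < b) (hab : b ≤ a) {x : Plane}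
    (hx : x ∈ ellipseInterior a b) (ω : ℝ) :
    ∃ m h, h ∈ Ioo 0 π ∧ m + h = ω ∧
      ∃ t ∈ Ioo (-sin h) (sin h), x = linePoint a b m h t := by
  have ha := hb.trans_le hab
  obtain ⟨X, hX⟩ : ∃ X, X = x 0 / a := ⟨_, rfl⟩
  obtain ⟨Y, hY⟩ : ∃ Y, Y = x 1 / b := ⟨_, rfl⟩
  have hx' : X ^ 2 + Y ^ 2 < 1 := by
    rw [hX, hY, div_pow, div_pow]; exact hx
  have hω := sin_sq_add_cos_sq ω
  have hdot : cos ω * X + sin ω * Y < 1 := by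
    nlinarith [sq_nonneg (cos ω - X), sq_nonneg (sin ω - Y)]
  obtain ⟨ρ, β, hρ, h1, h2⟩ := exists_polar (u := cos ω - X) (v := sin ω - Y) (by
    intro h0
    have e1 : cos ω - X = 0 := by
      rw [← sq_eq_zero_iff]; linarith [sq_nonneg (cos ω - X), sq_nonneg (sin ω - Y)]
    have e2 : sin ω - Y = 0 := by
      rw [← sq_eq_zero_iff]; linarith [sq_nonneg (cos ω - X), sq_nonneg (sin ω - Y)]
    rw [← sub_eq_zero.1 e1, ← sub_eq_zero.1 e2] at hx'
    linarith)
  -- The chord has relative direction `β`, the direction from `x` to its end, and therefore mean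
  -- angle `β - π / 2` modulo `2π`.
  obtain ⟨n, hn⟩ := exists_add_int_mul_two_pi_mem (ω - β + π / 2)
  set h := ω - β + π / 2 + n * (2 * π) with hh
  have hβ := sin_sq_add_cos_sq β
  have hsin : sin h = cos ω * cos β + sin ω * sin β := by
    rw [hh, sin_add_int_mul_two_pi, sin_add_pi_div_two, cos_sub]
  have hcos : cos h = sin β * cos ω - cos β * sin ω := by
    rw [hh, cos_add_int_mul_two_pi, cos_add_pi_div_two, sin_sub]; ring
  have hm : ω - h = β - π / 2 - n * (2 * π) := by rw [hh]; ring
  have hcm : cos (ω - h) = sin β := by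
    rw [hm, cos_sub_int_mul_two_pi, cos_sub_pi_div_two]
  have hsm : sin (ω - h) = -cos β := by
    rw [hm, sin_sub_int_mul_two_pi, sin_sub_pi_div_two]
  have hsp : 0 < sin h := by
    have : 0 < ρ * sin h := by
      rw [hsin]
      have : ρ * (cos ω * cos β + sin ω * sin β) = 1 - (cos ω * X + sin ω * Y) := by
        linear_combination -cos ω * h1 - sin ω * h2 + hω
      linarith
    exact pos_of_mul_pos_right this hρ.le
  have hh0 : 0 < h := by
    by_contra! h0
    linarith [sin_nonpos_of_nonpos_of_neg_pi_le h0 hn.1.le]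
  have hhπ : h < π := lt_of_le_of_ne hn.2 (fun e => by rw [e, sin_pi] at hsp; exact lt_irrefl _ hsp)
  have ht2 : (sin h - ρ) ^ 2 < sin h ^ 2 := by
    have e : cos h ^ 2 + (sin h - ρ) ^ 2 = X ^ 2 + Y ^ 2 := by
      rw [show X = cos ω - ρ * cos β by linarith, show Y = sin ω - ρ * sin β by linarith, hsin,
        hcos]
      linear_combination (sin ω ^ 2 + cos ω ^ 2 - ρ ^ 2) * hβ
    linarith [sin_sq_add_cos_sq h]
  refine ⟨ω - h, h, ⟨hh0, hhπ⟩, by ring, sin h - ρ, ?_, ?_⟩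
  · exact ⟨(abs_lt_of_sq_lt_sq' ht2 hsp.le).1, by linarith⟩
  · apply plane_ext
    · rw [linePoint_zero, hcm, hsm, hcos, hsin]
      have : x 0 = a * X := by rw [hX]; field_simp
      rw [this]
      congr 1
      linear_combination -h1 - cos ω * hβ
    · rw [linePoint_one, hcm, hsm, hcos, hsin]
      have : x 1 = b * Y := by rw [hY]; field_simp
      rw [this]
      congr 1
      linear_combination -h2 - sin ω * hβ

lemma boundaryPoint_eq_iff {a b : ℝ} (hb : 0 < b) (hab : b ≤ a) {θ φ : ℝ} :
    boundaryPoint a b θ = boundaryPoint a b φ ↔ ∃ n : ℤ, φ = θ + n * (2 * π) := by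
  have ha := hb.trans_le hab
  constructor
  · intro h
    have h0 : a * cos θ = a * cos φ := congrArg (fun p : Plane => p 0) h
    have h1 : b * sin θ = b * sin φ := congrArg (fun p : Plane => p 1) h
    have := Real.Angle.cos_sin_inj (mul_left_cancel₀ ha.ne' h0).symm
      (mul_left_cancel₀ hb.ne' h1).symm
    obtain ⟨n, hn⟩ := Real.Angle.angle_eq_iff_two_pi_dvd_sub.1 this
    exact ⟨n, by linarith⟩
  · rintro ⟨n, rfl⟩
    apply plane_ext <;> simp

/-- The broken geodesics making approximately one counterclockwise rotation, in terms of chords. -/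
theorem mem_oneRotationOrbits_iff {a b : ℝ} (hb : 0 < b) (hab : b ≤ a) {j : ℕ} (hj : 0 < j)
    {x y : Plane} (hx : x ∈ ellipseInterior a b) (q : Fin j → Plane) :
    q ∈ oneRotationOrbits a b j x y Sense.counterclockwise ↔
      ∃ m h, IsChordOrbit a b x y j m h ∧ q = impactPoints a b j m h := by
  constructor
  · rintro ⟨hq, φ, θ, hφ, hθ, h1, h2⟩
    have hsp := hφ.step_pos
    have hsl := hφ.step_lt
    simp only [Sense.sign, one_mul] at hsp hsl h2
    obtain ⟨m₀, h₀, hh₀, hm₀, t₀, ht₀, hxt⟩ := exists_chord_to hb hab hx (φ 0)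
    -- The impact angles are extended by the backward continuation of the first link, so that chord
    -- `k` runs from `ω k` to `ω (k + 1)`.
    obtain ⟨ω, hω0, hω⟩ : ∃ ω : ℕ → ℝ, ω 0 = m₀ - h₀ ∧ ∀ k, ω (k + 1) = φ k :=
      ⟨fun k => Nat.casesOn k (m₀ - h₀) φ, rfl, fun k => rfl⟩
    obtain ⟨m, hm⟩ : ∃ m : ℕ → ℝ, ∀ k, m k = (ω k + ω (k + 1)) / 2 := ⟨_, fun _ => rfl⟩
    obtain ⟨h, hh⟩ : ∃ h : ℕ → ℝ, ∀ k, h k = (ω (k + 1) - ω k) / 2 := ⟨_, fun _ => rfl⟩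
    have hadd : ∀ k, m k + h k = φ k := fun k => by rw [hm, hh, hω]; ring
    have hsub : ∀ k, m (k + 1) - h (k + 1) = φ k := fun k => by rw [hm, hh, hω]; ring
    have hm0 : m 0 = m₀ := by rw [hm, hω0, hω]; linarith
    have hh0 : h 0 = h₀ := by rw [hh, hω0, hω]; linarith
    have hqi : q = impactPoints a b j m h := by
      funext k
      rw [impactPoints, hadd, hφ.impact k k.2]
      simp [vertex]
    have hmem : ∀ k ≤ j, h k ∈ Ioo 0 π := by
      intro k hk
      rcases k with _ | k
      · rw [hh0]; exact hh₀
      · rw [hh, hω, hω]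
        exact ⟨by linarith [hsp k hk], by linarith [hsl k hk]⟩
    obtain ⟨i, rfl⟩ : ∃ i, j = i + 1 := ⟨j - 1, by omega⟩
    have hlast : ∃ t ∈ Ioo (-sin (h (i + 1))) (sin (h (i + 1))),
        y = linePoint a b (m (i + 1)) (h (i + 1)) t := by
      obtain ⟨-, r, hr, hz⟩ := hφ.next_impact
      have hs := sin_pos_of_mem_Ioo (hmem (i + 1) le_rfl)
      have hr0 : 0 < r := by linarith
      have hv : vertex x y q (i + 1) = linePoint a b (m (i + 1)) (h (i + 1))
          (-sin (h (i + 1))) := by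
        rw [← boundaryPoint_sub, hsub, hφ.impact i (by omega)]
      rw [hv, ← hadd, boundaryPoint_add] at hz
      refine ⟨-sin (h (i + 1)) + r⁻¹ * (sin (h (i + 1)) - -sin (h (i + 1))), ⟨?_, ?_⟩, ?_⟩
      · have := inv_pos.2 hr0
        nlinarith
      · have := inv_lt_one_of_one_lt₀ hr
        nlinarith
      · rw [← lineMap_linePoint, hz]
        simp only [AffineMap.lineMap_apply, vsub_eq_sub, vadd_eq_add, add_sub_cancel_right,
          smul_smul, inv_mul_cancel₀ hr0.ne', one_smul, sub_add_cancel]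
    have hp : IsChordPath a b x y (i + 1) m h :=
      ⟨hmem, fun k _ => by rw [hadd, hsub], ⟨t₀, by rwa [hh0], by rwa [hm0, hh0]⟩, hlast⟩
    obtain ⟨n, hn⟩ := (boundaryPoint_eq_iff hb hab).1 hθ
    have hL := perimeter_pos hb hab
    -- Two lifts of the same point differ by whole perimeters, so a tolerance below one perimeter
    -- leaves exactly one turn.
    have hn1 : n = 1 := by
      rw [hn, arclength_add_int_mul] at h2
      rw [show arclength a b θ + n * perimeter a b - arclength a b θ - perimeter a b =
        (n - 1) * perimeter a b by ring, abs_mul, abs_of_pos hL] at h2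
      have h3 : |(n : ℝ) - 1| < 1 := by
        by_contra! h4
        nlinarith
      have h4 : |n - 1| < 1 := by exact_mod_cast h3
      rw [Int.abs_lt_one_iff] at h4
      omega
    rw [hn1, Int.cast_one, one_mul] at hn
    have h3 := abs_le.1 ((abs_arclength_sub_le_iff hb hab _ _).1 h1)
    refine ⟨m, h, ⟨hp, (hp.isBrokenGeodesic_iff hb hab hj).1 (hqi ▸ hq), ?_, ?_⟩, hqi⟩
    · rw [hadd, hadd]; linarith
    · rw [hadd, hadd]; linarith
  · rintro ⟨m, h, ho, rfl⟩
    have hp := ho.toIsChordPath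
    have hd : ∀ k < j, m (k + 1) + h (k + 1) - (m k + h k) = 2 * h (k + 1) := fun k hk => by
      rw [← hp.step k hk]; ring
    refine ⟨(hp.isBrokenGeodesic_iff hb hab hj).2 ho.reflection, fun k => m k + h k,
      m j + h j - 2 * π, ⟨fun k hk => (vertex_impactPoints a b x y m h hk).symm,
        hp.isNextImpact hb hab hj, fun k hk => ?_, fun k hk => ?_⟩, ?_, ?_, ?_⟩
    · simp only [Sense.sign, one_mul, hd k hk]
      linarith [(hp.half_mem (k + 1) hk).1]
    · simp only [Sense.sign, one_mul, hd k hk]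
      linarith [(hp.half_mem (k + 1) hk).2]
    · exact (boundaryPoint_eq_iff hb hab).2 ⟨1, by push_cast; ring⟩
    · rw [abs_arclength_sub_le_iff hb hab, abs_le]
      constructor <;> linarith [ho.pi_le, ho.le_three_pi]
    · have := arclength_add_two_pi a b (m j + h j - 2 * π)
      rw [sub_add_cancel] at this
      rw [this]
      have hL := perimeter_pos hb hab
      simp only [Sense.sign, one_mul, add_sub_cancel_left, sub_self, abs_zero]
      positivity

/-! ### From chord orbits to the equations in the mean angles, and back. -/

/-- The point with relative polar coordinates `(r, ψ)`. -/
def polarPoint (a b r ψ : ℝ) : Plane := !₂[a * (r * cos ψ), b * (r * sin ψ)]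

lemma polarPoint_eq_linePoint (a b : ℝ) {r ψ m h t : ℝ} (h1 : r * cos (ψ - m) = cos h)
    (h2 : r * sin (ψ - m) = t) : polarPoint a b r ψ = linePoint a b m h t := by
  apply plane_ext
  · rw [linePoint_zero, ← h1, ← h2, cos_sub, sin_sub]
    change a * (r * cos ψ) = _
    linear_combination -a * r * cos ψ * sin_sq_add_cos_sq m
  · rw [linePoint_one, ← h1, ← h2, cos_sub, sin_sub]
    change b * (r * sin ψ) = _
    linear_combination -b * r * sin ψ * sin_sq_add_cos_sq m

lemma cos_of_polarPoint_eq_linePoint {a b : ℝ} (hb : 0 < b) (hab : b ≤ a) {r ψ m h t : ℝ}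
    (he : polarPoint a b r ψ = linePoint a b m h t) : r * cos (ψ - m) = cos h := by
  have h0 : a * (r * cos ψ) = a * (cos h * cos m - t * sin m) :=
    congrArg (fun p : Plane => p 0) he
  have h1 : b * (r * sin ψ) = b * (cos h * sin m + t * cos m) :=
    congrArg (fun p : Plane => p 1) he
  have h0 := mul_left_cancel₀ (hb.trans_le hab).ne' h0
  have h1 := mul_left_cancel₀ hb.ne' h1
  rw [cos_sub]
  linear_combination cos m * h0 + sin m * h1 + cos h * sin_sq_add_cos_sq m

lemma polarPoint_add_int_mul_two_pi (a b r ψ : ℝ) (n : ℤ) :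
    polarPoint a b r (ψ + n * (2 * π)) = polarPoint a b r ψ := by
  simp [polarPoint]

/-- Rotation is measured from the first impact, so the half-angle of chord `0` does not enter. -/
lemma IsChordPath.sum_half {a b : ℝ} {x y : Plane} {j : ℕ} {m h : ℕ → ℝ}
    (hp : IsChordPath a b x y j m h) {n : ℕ} (hn : n ≤ j) :
    (m n + h n) - (m 0 + h 0) = 2 * ∑ k ∈ Finset.range n, h (k + 1) := by
  induction n with
  | zero => simp
  | succ n ih =>
    rw [Finset.sum_range_succ, mul_add, ← ih (by omega), ← hp.step n (by omega)]
    ring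

namespace SmallRange

variable {a b c₀ c₁ : ℝ}

/-- The links of an orbit that makes approximately one rotation with sufficiently many reflections
are tangent to one confocal ellipse, close to the boundary. -/
lemma exists_halfStep_eq (hS : SmallRange a b c₀ c₁) {j : ℕ} (hj : 4 ≤ j) {x y : Plane}
    {m h : ℕ → ℝ} (ho : IsChordOrbit a b x y j m h)
    (hlow : 4 * j * (c₀ * a) ≤ 2) (hup : 20 ≤ 2 * j * (c₁ * b)) :
    ∃ c ∈ Icc c₀ c₁, ∀ k ≤ j, h k = halfStep a b c (m k) := by
  have hb := hS.b_pos
  have hab := hS.b_le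
  have ha := hS.a_pos
  have hj0 : (0 : ℝ) < j := by
    have : 0 < j := by omega
    exact_mod_cast this
  have hj4 : (4 : ℝ) ≤ j := by exact_mod_cast hj
  have hsum := ho.sum_half le_rfl
  have hne : (Finset.range j).Nonempty := Finset.nonempty_range_iff.2 (by omega)
  have hω : ∀ k, (m k + h k) - m k = h k := fun k => by ring
  have hω' : ∀ k < j, (m k + h k) - m (k + 1) = -h (k + 1) := fun k hk => by
    rw [← ho.step k hk]; ring
  have hrefl := fun k hk =>
    (chordDirection_eq_reflectAcross_iff hb hab _ _ _).1 (ho.reflection k hk)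
  have hc : ∀ k ≤ j, sin (h k) = sin (h 0) / speed a b (m 0) * speed a b (m k) := by
    intro k hk
    have : sin (h k) / speed a b (m k) = sin (h 0) / speed a b (m 0) := by
      induction k with
      | zero => rfl
      | succ k ih =>
        have h1 := (hrefl k hk).1
        rw [hω, ← neg_sub (m k + h k), hω' k hk, neg_neg] at h1
        rw [← h1, ih (by omega)]
    rw [← this, div_mul_cancel₀ _ (speed_pos hb hab _).ne']
  set c := sin (h 0) / speed a b (m 0) with hcd
  have hc0 : 0 < c := div_pos (ho.sin_pos (Nat.zero_le _)) (speed_pos hb hab _)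
  -- The total advance lies in `[π, 3π]`, so some half-angle is at most, and some is at least, the
  -- corresponding average. One of each suffices, as `c` is common to all chords.
  obtain ⟨k₁, hk₁, hlo⟩ : ∃ k ∈ Finset.range j, h (k + 1) ≤ 3 * π / 2 / j := by
    apply Finset.exists_le_of_sum_le hne
    rw [Finset.sum_const, Finset.card_range, nsmul_eq_mul, mul_div_cancel₀ _ hj0.ne']
    linarith [ho.le_three_pi]
  obtain ⟨k₂, hk₂, hhi⟩ : ∃ k ∈ Finset.range j, π / 2 / j ≤ h (k + 1) := by
    apply Finset.exists_le_of_sum_le hne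
    rw [Finset.sum_const, Finset.card_range, nsmul_eq_mul, mul_div_cancel₀ _ hj0.ne']
    linarith [ho.pi_le]
  have hk₁' : k₁ + 1 ≤ j := Finset.mem_range.1 hk₁
  have hk₂' : k₂ + 1 ≤ j := Finset.mem_range.1 hk₂
  rw [le_div_iff₀ hj0] at hlo
  rw [div_le_iff₀ hj0] at hhi
  have hc1 : c ≤ c₁ := by
    have i1 := sin_le (ho.half_mem _ hk₁').1.le
    rw [hc _ hk₁'] at i1
    have i2 : c * b ≤ c * speed a b (m (k₁ + 1)) :=
      mul_le_mul_of_nonneg_left (le_speed hb hab _) hc0.le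
    have i3 : c * b * j ≤ 3 * π / 2 := (mul_le_mul_of_nonneg_right (i2.trans i1) hj0.le).trans hlo
    by_contra! i4
    have i5 : c₁ * b * j ≤ c * b * j := by gcongr
    linarith [pi_le_four]
  have hsin : ∀ k ≤ j, sin (h k) ^ 2 ≤ (c₁ * a) ^ 2 := fun k hk => by
    apply pow_le_pow_left₀ (ho.sin_pos hk).le
    rw [hc k hk]
    exact mul_le_mul hc1 (speed_le hb hab _) (speed_pos hb hab _).le (hc0.le.trans hc1)
  -- The sine does not distinguish `h` from `π - h`. Reflection preserves the sign of the tangential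
  -- component, so the half-angles are all below `π / 2` or none is.
  have hiff : ∀ k < j, (0 < cos (h k) ↔ 0 < cos (h (k + 1))) := by
    intro k hk
    have i1 := tangential_sign hb hab hS.threshold (m := m k) (ω := m k + h k)
      (by rw [hω]; exact hsin k hk.le)
    have i2 := tangential_sign hb hab hS.threshold (m := m (k + 1)) (ω := m k + h k)
      (by rw [hω' k hk, sin_neg, neg_sq]; exact hsin (k + 1) hk)
    rw [hω] at i1
    rw [hω' k hk, cos_neg] at i2
    rw [← i1, ← i2, ← div_pos_iff_of_pos_right (speed_pos hb hab (m k)), (hrefl k hk).2,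
      div_pos_iff_of_pos_right (speed_pos hb hab (m (k + 1)))]
  have hiff0 : ∀ k ≤ j, (0 < cos (h k) ↔ 0 < cos (h 0)) := by
    intro k hk
    induction k with
    | zero => rfl
    | succ k ih => rw [← hiff k hk, ih (by omega)]
  have hcos0 : 0 < cos (h 0) := by
    rw [← hiff0 _ hk₁']
    have i1 := (ho.half_mem _ hk₁').1
    apply cos_pos_of_mem_Ioo ⟨by linarith [pi_pos], ?_⟩
    nlinarith [pi_pos]
  have hlt : ∀ k ≤ j, h k < π / 2 := by
    intro k hk
    by_contra! i1
    have i2 := cos_nonpos_of_pi_div_two_le_of_le i1 (by linarith [(ho.half_mem k hk).2, pi_pos])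
    linarith [(hiff0 k hk).2 hcos0]
  refine ⟨c, ⟨?_, hc1⟩, fun k hk => ?_⟩
  -- Jordan's inequality, available now that `h < π / 2`, gives `c * a * j ≥ 1`, whereas `c₀ * a * j
  -- ≤ 1 / 2`.
  · have i1 := mul_le_sin (ho.half_mem _ hk₂').1.le (hlt _ hk₂').le
    rw [hc _ hk₂'] at i1
    have i2 : c * speed a b (m (k₂ + 1)) ≤ c * a :=
      mul_le_mul_of_nonneg_left (speed_le hb hab _) hc0.le
    have i3 : 1 ≤ 2 / π * h (k₂ + 1) * j := by
      rw [mul_assoc, div_mul_eq_mul_div, le_div_iff₀ pi_pos]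
      linarith
    have i4 : 1 ≤ c * a * j := i3.trans (mul_le_mul_of_nonneg_right (i1.trans i2) hj0.le)
    by_contra! i5
    have i6 : c * a * j ≤ c₀ * a * j := by gcongr
    linarith
  · rw [halfStep, ← hc k hk, arcsin_sin (by linarith [(ho.half_mem k hk).1, pi_pos])
      (hlt k hk).le]

lemma eq_sign_mul_offset {r δ h : ℝ} (hr : 0 < r) (hδ : δ ∈ Ioc (-π) π)
    (hc : r * cos δ = cos h) : ∃ t : LinkType, δ = t.sign * offset r h := by
  have e : offset r h = |δ| := by
    rw [offset, ← hc, mul_div_cancel_left₀ _ hr.ne', ← cos_abs,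
      arccos_cos (abs_nonneg _) (abs_le.2 ⟨hδ.1.le, hδ.2⟩)]
  rw [e]
  rcases le_total 0 δ with h0 | h0
  · exact ⟨.T, by rw [abs_of_nonneg h0]; simp [LinkType.sign]⟩
  · exact ⟨.N, by rw [abs_of_nonpos h0]; simp [LinkType.sign]⟩

lemma halfStep_add_int_mul_two_pi (a b c m : ℝ) (n : ℤ) :
    halfStep a b c (m + n * (2 * π)) = halfStep a b c m := by
  simp [halfStep, speed]

/-- Every orbit that makes approximately one rotation is determined by its Joachimsthal constant
and by the types of its first and last links. -/
lemma exists_connects_of_isChordOrbit (hS : SmallRange a b c₀ c₁) {j : ℕ} (hj : 4 ≤ j)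
    {r ψ r' ψ' : ℝ} (hr : NearOne a b c₀ r) (hr' : NearOne a b c₀ r') (hψ : |ψ' - ψ| ≤ 1)
    (hlow : 4 * j * (c₀ * a) ≤ 2) (hup : 20 ≤ 2 * j * (c₁ * b)) {m h : ℕ → ℝ}
    (ho : IsChordOrbit a b (polarPoint a b r ψ) (polarPoint a b r' ψ') j m h) :
    ∃ first last c m', Connects a b c₀ c₁ r ψ r' ψ' j first last c m' ∧
      impactPoints a b j m h = impactPoints a b j m' (fun k => halfStep a b c (m' k)) := by
  obtain ⟨c, hc, hh⟩ := hS.exists_halfStep_eq hj ho hlow hup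
  obtain ⟨n, hn⟩ := exists_add_int_mul_two_pi_mem (m 0 - ψ)
  have hper := fun k => halfStep_add_int_mul_two_pi a b c (m k) n
  obtain ⟨t, -, ht⟩ := ho.first
  obtain ⟨t', -, ht'⟩ := ho.last
  have hcos : r * cos (m 0 - ψ + n * (2 * π)) = cos (halfStep a b c (m 0 + n * (2 * π))) := by
    rw [cos_add_int_mul_two_pi, ← cos_neg, neg_sub, hper, ← hh 0 (Nat.zero_le _)]
    exact cos_of_polarPoint_eq_linePoint hS.b_pos hS.b_le ht
  obtain ⟨first, hfirst⟩ := eq_sign_mul_offset hr.pos hn hcos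
  obtain ⟨n', hn'⟩ := exists_add_int_mul_two_pi_mem (ψ' - (m j + n * (2 * π)))
  have hcos' : r' * cos (ψ' - (m j + n * (2 * π)) + n' * (2 * π)) =
      cos (halfStep a b c (m j + n * (2 * π))) := by
    rw [cos_add_int_mul_two_pi, ← sub_sub, cos_sub_int_mul_two_pi, hper, ← hh j le_rfl]
    exact cos_of_polarPoint_eq_linePoint hS.b_pos hS.b_le ht'
  obtain ⟨last, hlast⟩ := eq_sign_mul_offset hr'.pos hn' hcos'
  have i1 := abs_le.1 (hS.abs_sign_mul_offset_le hr hc first (m 0 + n * (2 * π)))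
  have i2 := abs_le.1 (hS.abs_sign_mul_offset_le hr' hc last (m j + n * (2 * π)))
  have i3 := abs_le.1 hψ
  have i4 := hS.halfStep_pos hc (m 0)
  have i5 := hS.halfStep_pos hc (m j)
  have i6 := hS.halfStep_le hc (m 0)
  have i7 := hS.halfStep_le hc (m j)
  have i8 := ho.pi_le
  have i9 := ho.le_three_pi
  rw [hh 0 (Nat.zero_le _), hh j le_rfl] at i8 i9
  -- The advance between `π` and `3π`, corrected by the small half-steps, offsets and `ψ' - ψ`,
  -- leaves `0 < n' < 2`.
  have hn1 : n' = 1 := by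
    have h1 : ((n' : ℝ) - 1) * (2 * π) < 2 * π := by nlinarith [pi_gt_three]
    have h2 : -(2 * π) < ((n' : ℝ) - 1) * (2 * π) := by nlinarith [pi_gt_three]
    have h3 : (n' : ℝ) < 2 := by nlinarith [pi_gt_three]
    have h4 : (0 : ℝ) < n' := by nlinarith [pi_gt_three]
    have h3' : n' < 2 := by exact_mod_cast h3
    have h4' : 0 < n' := by exact_mod_cast h4
    omega
  rw [hn1, Int.cast_one, one_mul] at hlast
  refine ⟨first, last, c, fun k => m k + n * (2 * π), ⟨hc, fun k hk => ?_, ?_, ?_⟩, ?_⟩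
  · simp only [hper]
    have := ho.step k hk
    rw [hh k hk.le, hh (k + 1) hk] at this
    linarith
  · linarith
  · linarith
  · funext k
    simp only [impactPoints, hper]
    rw [boundaryPoint_eq_iff hS.b_pos hS.b_le]
    exact ⟨n, by rw [hh k k.2.le]; ring⟩

/-- The position of a point on a chord that it lies on. -/
lemma polarPoint_eq (hS : SmallRange a b c₀ c₁) {r ψ m h : ℝ} (hr : NearOne a b c₀ r)
    (hh : h ∈ Icc (arcsin (c₀ * b)) (1 / 10)) (t : LinkType) (hm : ψ - m = t.sign * offset r h) :
    polarPoint a b r ψ = linePoint a b m h (t.sign * √(r ^ 2 - cos h ^ 2)) := by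
  apply polarPoint_eq_linePoint
  · rw [hm, ← hS.cos_offset hr hh]
    cases t <;> simp [LinkType.sign]
  · rw [hm, ← hS.sin_offset hr hh]
    cases t <;> simp [LinkType.sign]

/-- The given point lies in an outer quarter of the chord, because `1 - r ^ 2` is less than a
quarter of `sin h ^ 2`. -/
lemma sqrt_mem (hS : SmallRange a b c₀ c₁) {r h : ℝ} (hr : NearOne a b c₀ r)
    (hh : h ∈ Icc (arcsin (c₀ * b)) (1 / 10)) :
    sin h / 2 < √(r ^ 2 - cos h ^ 2) ∧ √(r ^ 2 - cos h ^ 2) < sin h := by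
  have h0 := hS.lower_mul_b_pos.trans_le (hS.le_sin_of_mem hh)
  have h1 := hS.four_mul_one_sub_sq_lt hr hh
  have h2 := sin_sq_add_cos_sq h
  have h3 : r ^ 2 < 1 := by nlinarith [hr.pos, hr.lt_one]
  constructor
  · apply lt_sqrt_of_sq_lt
    nlinarith
  · rw [sqrt_lt' h0]
    linarith

lemma sign_mul_sqrt_mem (hS : SmallRange a b c₀ c₁) {r h : ℝ} (hr : NearOne a b c₀ r)
    (hh : h ∈ Icc (arcsin (c₀ * b)) (1 / 10)) (t : LinkType) :
    t.sign * √(r ^ 2 - cos h ^ 2) ∈ Ioo (-sin h) (sin h) := by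
  have h1 := hS.sqrt_mem hr hh
  have h0 := hS.lower_mul_b_pos.trans_le (hS.le_sin_of_mem hh)
  cases t
  · simp only [LinkType.sign, one_mul]
    exact ⟨by linarith, h1.2⟩
  · simp only [LinkType.sign, neg_one_mul]
    exact ⟨by linarith, by linarith⟩

/-- The tangency parameter is of order `c ^ 2`, the half-length `sin h` of the parameter interval of
order `c`. So tangency occurs in the middle half of the chord. -/
lemma abs_tangencyParameter_lt (hS : SmallRange a b c₀ c₁) {c : ℝ} (hc : c ∈ Icc c₀ c₁) (m : ℝ) :
    |tangencyParameter a b c m (halfStep a b c m)| < sin (halfStep a b c m) / 2 := by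
  have ha := hS.a_pos
  have hb := hS.b_pos
  have hc0 := hS.lower_pos.trans_le hc.1
  have hsin := hS.sin_halfStep hc m
  have hcos := hS.cos_pos_of_mem (hS.halfStep_mem hc m)
  have h1 : 1 / 2 ≤ cos (halfStep a b c m) := by
    have := sin_sq_add_cos_sq (halfStep a b c m)
    rw [hsin] at this
    nlinarith [hS.mul_speed_le hc m, hS.mul_speed_pos hc m]
  have h2 : c * a ^ 2 ≤ b / 8 := by
    have h3 := hS.lipschitz
    rw [← mul_div_assoc, div_le_iff₀ hb] at h3
    have : c * a ^ 2 ≤ c₁ * a ^ 2 := mul_le_mul_of_nonneg_right hc.2 (sq_nonneg a)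
    linarith
  have h3 : |c ^ 2 * (a ^ 2 - b ^ 2) * (sin m * cos m)| ≤ c * (b / 8) := by
    have hsq : b ^ 2 ≤ a ^ 2 := by have := hS.b_le; gcongr
    have i1 : |sin m * cos m| ≤ 1 := by
      rw [abs_mul]
      exact mul_le_one₀ (abs_sin_le_one m) (abs_nonneg _) (abs_cos_le_one m)
    rw [abs_mul, abs_of_nonneg (mul_nonneg (sq_nonneg c) (sub_nonneg.2 hsq))]
    calc c ^ 2 * (a ^ 2 - b ^ 2) * |sin m * cos m| ≤ c ^ 2 * (a ^ 2 - b ^ 2) * 1 := by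
          gcongr
      _ ≤ c * (c * a ^ 2) := by nlinarith [mul_pos (pow_pos hc0 2) (pow_pos hb 2)]
      _ ≤ c * (b / 8) := by gcongr
  rw [tangencyParameter, abs_div, abs_neg, abs_of_pos hcos, div_lt_iff₀ hcos, hsin]
  have h4 := hS.mul_b_le_mul_speed hc m
  have h5 : 0 < c * b := mul_pos hc0 hb
  nlinarith

/-- The orbits with given Joachimsthal constant do make approximately one rotation. -/
lemma isChordOrbit_of_connects (hS : SmallRange a b c₀ c₁) {j : ℕ}
    {r ψ r' ψ' : ℝ} (hr : NearOne a b c₀ r) (hr' : NearOne a b c₀ r') (hψ : |ψ' - ψ| ≤ 1)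
    {first last : LinkType} {c : ℝ} {m : ℕ → ℝ}
    (hm : Connects a b c₀ c₁ r ψ r' ψ' j first last c m) :
    IsChordOrbit a b (polarPoint a b r ψ) (polarPoint a b r' ψ') j m
      (fun k => halfStep a b c (m k)) := by
  have hc := hm.mem
  have hb := hS.b_pos
  have hab := hS.b_le
  have i1 := abs_le.1 (hS.abs_sign_mul_offset_le hr hc first (m 0))
  have i2 := abs_le.1 (hS.abs_sign_mul_offset_le hr' hc last (m j))
  have i3 := abs_le.1 hψ
  have i4 := hS.halfStep_pos hc (m 0)
  have i5 := hS.halfStep_pos hc (m j)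
  have i6 := hS.halfStep_le hc (m 0)
  have i7 := hS.halfStep_le hc (m j)
  have i8 := hm.start
  have i9 := hm.finish
  refine ⟨⟨fun k _ => ⟨hS.halfStep_pos hc _, by linarith [hS.halfStep_le hc (m k), pi_gt_three]⟩,
    hm.step, ?_, ?_⟩, fun k hk => ?_, ?_, ?_⟩
  -- A first link of type `T` has `x` before the midpoint, where the parameter is negative; hence
  -- the flipped sign.
  · let t : LinkType := match first with | .T => .N | .N => .T
    have ht : t.sign = -first.sign := by cases first <;> simp [t, LinkType.sign]
    exact ⟨_, hS.sign_mul_sqrt_mem hr (hS.halfStep_mem hc _) t,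
      hS.polarPoint_eq hr (hS.halfStep_mem hc _) t (by rw [ht]; linarith)⟩
  · refine ⟨_, hS.sign_mul_sqrt_mem hr' (hS.halfStep_mem hc _) last, ?_⟩
    rw [← hS.polarPoint_eq hr' (ψ := ψ' + 2 * π) (hS.halfStep_mem hc _) last (by linarith)]
    simpa using (polarPoint_add_int_mul_two_pi a b r' ψ' 1).symm
  · rw [chordDirection_eq_reflectAcross_iff hb hab]
    set ω := m k + halfStep a b c (m k) with hω
    have e1 : ω - m k = halfStep a b c (m k) := by rw [hω]; ring
    have e2 : ω - m (k + 1) = -halfStep a b c (m (k + 1)) := by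
      rw [hω, ← hm.step k hk]; ring
    have s1 := hS.sin_halfStep hc (m k)
    have s2 := hS.sin_halfStep hc (m (k + 1))
    have p1 := speed_pos hb hab (m k)
    have p2 := speed_pos hb hab (m (k + 1))
    have hsq : ∀ n, sin (halfStep a b c n) ^ 2 ≤ (c₁ * a) ^ 2 := fun n => by
      rw [hS.sin_halfStep hc]
      apply pow_le_pow_left₀ (hS.mul_speed_pos hc n).le
      exact mul_le_mul hc.2 (speed_le hb hab _) (speed_pos hb hab _).le
        (hS.lower_pos.le.trans hS.lower_le)
    have t1 : 0 < tangential a b (m k) ω := by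
      rw [tangential_sign hb hab hS.threshold (by rw [e1]; exact hsq _), e1]
      exact hS.cos_pos_of_mem (hS.halfStep_mem hc _)
    have t2 : 0 < tangential a b (m (k + 1)) ω := by
      rw [tangential_sign hb hab hS.threshold (by rw [e2, sin_neg, neg_sq]; exact hsq _), e2,
        cos_neg]
      exact hS.cos_pos_of_mem (hS.halfStep_mem hc _)
    constructor
    · rw [e1, ← neg_sub ω, e2, neg_neg, s1, s2, mul_div_cancel_right₀ _ p1.ne',
        mul_div_cancel_right₀ _ p2.ne']
    -- Equal normal components of unit vectors give equal squares of the tangential ones; both are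
    -- positive.
    · have q1 := tangential_sq hb hab (m k) ω
      have q2 := tangential_sq hb hab (m (k + 1)) ω
      rw [e1, s1] at q1
      rw [e2, sin_neg, neg_sq, s2] at q2
      apply (pow_left_inj₀ (div_pos t1 p1).le (div_pos t2 p2).le two_ne_zero).1
      rw [div_pow, div_pow, div_eq_div_iff (by positivity) (by positivity)]
      linear_combination speed a b (m (k + 1)) ^ 2 * q1 - speed a b (m k) ^ 2 * q2
  · linarith [pi_gt_three]
  · linarith [pi_gt_three]

/-- The types of the first and the last links of an orbit. -/
lemma linkTypes_of_connects (hS : SmallRange a b c₀ c₁) {j : ℕ} (hj : 2 ≤ j)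
    {r ψ r' ψ' : ℝ} (hr : NearOne a b c₀ r) (hr' : NearOne a b c₀ r') (hψ : |ψ' - ψ| ≤ 1)
    {first last : LinkType} {c : ℝ} {m : ℕ → ℝ}
    (hm : Connects a b c₀ c₁ r ψ r' ψ' j first last c m) :
    FirstLinkHasType a b (polarPoint a b r ψ) (polarPoint a b r' ψ')
        (impactPoints a b j m fun k => halfStep a b c (m k)) first ∧
      LastLinkHasType a b (polarPoint a b r ψ) (polarPoint a b r' ψ')
        (impactPoints a b j m fun k => halfStep a b c (m k)) last := by
  have hp := (hS.isChordOrbit_of_connects hr hr' hψ hm).toIsChordPath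
  have hc := hm.mem
  have hb := hS.b_pos
  have hab := hS.b_le
  have hca : c * a < 1 := by
    have : c * a ≤ c₁ * a := mul_le_mul_of_nonneg_right hc.2 hS.a_pos.le
    linarith [hS.mul_a_le]
  have htan : ∀ (k : ℕ) {s t : ℝ}, s < t →
      (LinkIsTangent a b (linePoint a b (m k) (halfStep a b c (m k)) s)
        (linePoint a b (m k) (halfStep a b c (m k)) t) ↔
      tangencyParameter a b c (m k) (halfStep a b c (m k)) ∈ Icc s t) := fun k s t hst =>
    linkIsTangent_linePoint_iff hb hab (hS.lower_pos.trans_le hc.1) hca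
      (hS.cos_pos_of_mem (hS.halfStep_mem hc _)) (hS.sin_halfStep hc _) hst
  have hlt := fun k => abs_lt.1 (hS.abs_tangencyParameter_lt hc (m k))
  have hsin := fun k => hS.mul_speed_pos hc (m k)
  have hstart := hm.start
  have hfinish := hm.finish
  have hD := hS.sqrt_mem hr (hS.halfStep_mem hc (m 0))
  have hD' := hS.sqrt_mem hr' (hS.halfStep_mem hc (m j))
  simp only [← hS.sin_halfStep hc] at hsin
  constructor
  · have v1 := IsChordPath.vertex_end (a := a) (b := b) (polarPoint a b r ψ)
      (polarPoint a b r' ψ') m (fun k => halfStep a b c (m k)) (by omega : 0 < j)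
    cases first with
    | T =>
      have hx := hS.polarPoint_eq hr (hS.halfStep_mem hc (m 0)) LinkType.N (ψ := ψ) (m := m 0)
        (by simp only [LinkType.sign] at hstart ⊢; linarith)
      simp only [LinkType.sign, neg_one_mul] at hx
      change LinkIsTangent a b _ _
      rw [v1, hx, htan 0 (by linarith [hsin 0])]
      constructor <;> linarith [(hlt 0).1, (hlt 0).2, hsin 0]
    | N =>
      have hx := hS.polarPoint_eq hr (hS.halfStep_mem hc (m 0)) LinkType.T (ψ := ψ) (m := m 0)
        (by simp only [LinkType.sign] at hstart ⊢; linarith)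
      simp only [LinkType.sign, one_mul] at hx
      change ¬ LinkIsTangent a b _ _ ∧ LinkIsTangent a b _ _
      constructor
      · rw [v1, hx, htan 0 (by linarith [hsin 0])]
        intro h
        linarith [h.1, (hlt 0).2, hsin 0]
      · rw [hp.vertex_start one_pos (by omega), IsChordPath.vertex_end _ _ _ _ (by omega : 1 < j),
          htan 1 (by linarith [hsin 1])]
        constructor <;> linarith [(hlt 1).1, (hlt 1).2, hsin 1]
  · have vj := hp.vertex_start (by omega : 0 < j) le_rfl
    have hy := hS.polarPoint_eq hr' (hS.halfStep_mem hc (m j)) last (ψ := ψ' + 2 * π) (m := m j)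
        (by linarith)
    rw [show polarPoint a b r' (ψ' + 2 * π) = polarPoint a b r' ψ' by
      simpa using polarPoint_add_int_mul_two_pi a b r' ψ' 1] at hy
    have hz := hp.isNextImpact hb hab (by omega)
    cases last with
    | T =>
      simp only [LinkType.sign, one_mul] at hy
      change LinkIsTangent a b _ _
      rw [vj, hy, htan j (by linarith [hsin j])]
      constructor <;> linarith [(hlt j).1, (hlt j).2, hsin j]
    | N =>
      simp only [LinkType.sign, neg_one_mul] at hy
      refine ⟨?_, _, hz, ?_⟩
      · rw [vj, hy, htan j (by linarith [hsin j])]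
        intro h
        linarith [h.2, (hlt j).1, hsin j]
      · rw [boundaryPoint_add, hy, htan j (by linarith [hsin j])]
        constructor <;> linarith [(hlt j).1, (hlt j).2, hsin j]

end SmallRange

/-! ### The two senses of rotation -/

/-- The reflection of the plane in the horizontal axis. -/
def conj (p : Plane) : Plane := !₂[p 0, -p 1]

@[simp] lemma conj_zero (p : Plane) : conj p 0 = p 0 := rfl
@[simp] lemma conj_one (p : Plane) : conj p 1 = -p 1 := rfl

@[simp] lemma conj_conj (p : Plane) : conj (conj p) = p := by
  apply plane_ext <;> simp

lemma conj_injective : Function.Injective conj := fun p q h => by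
  rw [← conj_conj p, h, conj_conj]

/-- The opposite sense of rotation. -/
def Sense.flip : Sense → Sense
  | counterclockwise => clockwise
  | clockwise => counterclockwise

lemma Sense.sign_flip (s : Sense) : s.flip.sign = -s.sign := by
  cases s <;> simp [Sense.flip, Sense.sign]

@[simp] lemma Sense.flip_flip (s : Sense) : s.flip.flip = s := by cases s <;> rfl

lemma conj_mem_boundary {a b : ℝ} {p : Plane} (hp : p ∈ ellipseBoundary a b) :
    conj p ∈ ellipseBoundary a b := by
  simpa [ellipseBoundary] using hp

lemma conj_boundaryPoint (a b φ : ℝ) : conj (boundaryPoint a b φ) = boundaryPoint a b (-φ) := by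
  apply plane_ext <;> simp

lemma vertex_conj {j : ℕ} (x y : Plane) (q : Fin j → Plane) (k : ℕ) :
    vertex (conj x) (conj y) (conj ∘ q) k = conj (vertex x y q k) := by
  rcases k with _ | k
  · rfl
  · simp only [vertex]
    split_ifs <;> rfl

lemma direction_conj (p q : Plane) : direction (conj p) (conj q) = conj (direction p q) := by
  have : ‖conj q - conj p‖ = ‖q - p‖ := by
    rw [EuclideanSpace.norm_eq, EuclideanSpace.norm_eq, Fin.sum_univ_two, Fin.sum_univ_two]
    congr 1
    simp only [PiLp.sub_apply, conj_zero, conj_one, Real.norm_eq_abs, sq_abs]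
    ring
  apply plane_ext
  · simp [direction, this]
  · simp only [direction, this, PiLp.smul_apply, PiLp.sub_apply, conj_one, smul_eq_mul]
    ring

lemma reflectAcross_conj (n v : Plane) :
    reflectAcross (conj n) (conj v) = conj (reflectAcross n v) := by
  apply plane_ext <;> simp only [reflectAcross, inner_plane, conj_zero, conj_one, PiLp.smul_apply,
    PiLp.sub_apply, smul_eq_mul, neg_mul_neg]
  ring

lemma outwardNormal_conj (a b : ℝ) (p : Plane) :
    outwardNormal a b (conj p) = conj (outwardNormal a b p) := by
  apply plane_ext <;> simp [neg_div]

lemma isNextImpact_conj {a b : ℝ} {p y z : Plane} (h : IsNextImpact a b p y z) :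
    IsNextImpact a b (conj p) (conj y) (conj z) := by
  obtain ⟨h1, r, hr, rfl⟩ := h
  refine ⟨conj_mem_boundary h1, r, hr, ?_⟩
  apply plane_ext
  · simp [AffineMap.lineMap_apply]
  · simp [AffineMap.lineMap_apply]; ring

lemma arclength_neg (a b φ : ℝ) : arclength a b (-φ) = -arclength a b φ := by
  have := intervalIntegral.integral_comp_neg (a := 0) (b := φ) (speed a b)
  rw [neg_zero, intervalIntegral.integral_symm 0 (-φ)] at this
  have h2 : ∫ t in (0 : ℝ)..φ, speed a b (-t) = arclength a b φ := by
    simp [arclength, speed]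
  rw [h2] at this
  rw [this, neg_neg]
  rfl

/-- The reflection is a symmetry of the billiard that negates lifted angles and arclengths. It
reverses the sense without exchanging the roles of `x` and `y`. -/
lemma conj_mem_oneRotationOrbits {a b : ℝ} {j : ℕ} {x y : Plane} {s : Sense} {q : Fin j → Plane}
    (hq : q ∈ oneRotationOrbits a b j x y s) :
    conj ∘ q ∈ oneRotationOrbits a b j (conj x) (conj y) s.flip := by
  obtain ⟨hg, φ, θ, hφ, hθ, h1, h2⟩ := hq
  refine ⟨⟨fun m => conj_mem_boundary (hg.mem_boundary m), fun m hm => ?_, fun m hm => ?_⟩,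
    fun k => -φ k, -θ, ⟨fun m hm => ?_, ?_, fun m hm => ?_, fun m hm => ?_⟩, ?_, ?_, ?_⟩
  · rw [vertex_conj, vertex_conj]
    exact fun h => hg.link_ne m hm (conj_injective h)
  · simp only [vertex_conj, direction_conj, outwardNormal_conj, reflectAcross_conj]
    rw [hg.reflection m hm]
  · rw [vertex_conj, ← hφ.impact m hm, conj_boundaryPoint]
  · rw [vertex_conj, ← conj_boundaryPoint]
    exact isNextImpact_conj hφ.next_impact
  · rw [s.sign_flip]; linarith [hφ.step_pos m hm]
  · rw [s.sign_flip]; linarith [hφ.step_lt m hm]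
  · rw [← conj_boundaryPoint, ← conj_boundaryPoint, hθ]
  · simp only [arclength_neg]
    rwa [neg_sub_neg, abs_sub_comm]
  · simp only [arclength_neg, s.sign_flip]
    rw [← abs_neg]
    refine (congrArg abs ?_).trans_le h2
    ring

lemma linkIsTangent_conj {a b : ℝ} {p p' : Plane} (h : LinkIsTangent a b p p') :
    LinkIsTangent a b (conj p) (conj p') := by
  obtain ⟨z, ⟨u, v, hu, hv, huv, rfl⟩, lam, h0, h1, h2, h3⟩ := h
  refine ⟨conj (u • p + v • p'), ⟨u, v, hu, hv, huv, ?_⟩, lam, h0, h1, ?_, ?_⟩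
  · apply plane_ext <;> simp
    ring
  · change (conj (u • p + v • p')) 0 ^ 2 / _ + (conj (u • p + v • p')) 1 ^ 2 / _ = 1
    rw [conj_zero, conj_one, neg_sq]
    exact h2
  · rw [← h3]
    simp only [conj_zero, conj_one, PiLp.sub_apply]
    ring

lemma linkIsTangent_conj_iff {a b : ℝ} {p p' : Plane} :
    LinkIsTangent a b (conj p) (conj p') ↔ LinkIsTangent a b p p' :=
  ⟨fun h => by simpa using linkIsTangent_conj h, linkIsTangent_conj⟩

lemma firstLinkHasType_conj {a b : ℝ} {j : ℕ} {x y : Plane} {q : Fin j → Plane} {t : LinkType}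
    (h : FirstLinkHasType a b x y q t) :
    FirstLinkHasType a b (conj x) (conj y) (conj ∘ q) t := by
  cases t <;> simpa only [FirstLinkHasType, vertex_conj, linkIsTangent_conj_iff] using h

lemma lastLinkHasType_conj {a b : ℝ} {j : ℕ} {x y : Plane} {q : Fin j → Plane} {t : LinkType}
    (h : LastLinkHasType a b x y q t) :
    LastLinkHasType a b (conj x) (conj y) (conj ∘ q) t := by
  cases t
  · simpa only [LastLinkHasType, vertex_conj, linkIsTangent_conj_iff] using h
  · obtain ⟨h1, z, h2, h3⟩ := h
    refine ⟨?_, conj z, ?_, linkIsTangent_conj h3⟩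
    · simpa only [vertex_conj, linkIsTangent_conj_iff] using h1
    · rw [vertex_conj]; exact isNextImpact_conj h2

lemma firstLinkHasType_unique {a b : ℝ} {j : ℕ} {x y : Plane} {q : Fin j → Plane} {t t' : LinkType}
    (h : FirstLinkHasType a b x y q t) (h' : FirstLinkHasType a b x y q t') : t = t' := by
  cases t <;> cases t'
  · rfl
  · exact absurd h h'.1
  · exact absurd h' h.1
  · rfl

lemma lastLinkHasType_unique {a b : ℝ} {j : ℕ} {x y : Plane} {q : Fin j → Plane} {t t' : LinkType}
    (h : LastLinkHasType a b x y q t) (h' : LastLinkHasType a b x y q t') : t = t' := by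
  cases t <;> cases t'
  · rfl
  · exact absurd h h'.1
  · exact absurd h' h.1
  · rfl

/-- There are exactly four orbits, exactly one of each pair of types. -/
def HasFourOrbits (a b : ℝ) (j : ℕ) (x y : Plane) (s : Sense) : Prop :=
  ∃ f : LinkType → LinkType → Fin j → Plane,
    (∀ first last, f first last ∈ oneRotationOrbits a b j x y s ∧
      FirstLinkHasType a b x y (f first last) first ∧
      LastLinkHasType a b x y (f first last) last) ∧
    ∀ q ∈ oneRotationOrbits a b j x y s, ∃ first last, q = f first last

lemma HasFourOrbits.conj {a b : ℝ} {j : ℕ} {x y : Plane} {s : Sense}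
    (h : HasFourOrbits a b j x y s) :
    HasFourOrbits a b j (conj x) (conj y) s.flip := by
  obtain ⟨f, h1, h2⟩ := h
  refine ⟨fun t t' => EllipseBilliard.conj ∘ f t t', fun t t' =>
    ⟨conj_mem_oneRotationOrbits (h1 t t').1, firstLinkHasType_conj (h1 t t').2.1, lastLinkHasType_conj (h1 t t').2.2⟩, fun q hq => ?_⟩
  have := conj_mem_oneRotationOrbits hq
  simp only [conj_conj, Sense.flip_flip] at this
  obtain ⟨t, t', h⟩ := h2 _ this
  refine ⟨t, t', ?_⟩
  simp only [← h]
  funext k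
  simp

lemma HasFourOrbits.existsUnique {a b : ℝ} {j : ℕ} {x y : Plane} {s : Sense}
    (h : HasFourOrbits a b j x y s) (first last : LinkType) :
    ∃! q : Fin j → Plane, q ∈ oneRotationOrbits a b j x y s ∧
      FirstLinkHasType a b x y q first ∧ LastLinkHasType a b x y q last := by
  obtain ⟨f, h1, h2⟩ := h
  refine ⟨f first last, h1 first last, ?_⟩
  rintro q ⟨hq, hq1, hq2⟩
  obtain ⟨t, t', rfl⟩ := h2 q hq
  rw [firstLinkHasType_unique hq1 (h1 t t').2.1, lastLinkHasType_unique hq2 (h1 t t').2.2]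

lemma HasFourOrbits.encard_eq {a b : ℝ} {j : ℕ} {x y : Plane} {s : Sense}
    (h : HasFourOrbits a b j x y s) : (oneRotationOrbits a b j x y s).encard = 4 := by
  obtain ⟨f, h1, h2⟩ := h
  have hne : ∀ {t u t' u'}, f t u = f t' u' → t = t' ∧ u = u' := fun {t u t' u'} e =>
    ⟨firstLinkHasType_unique (h1 t u).2.1 (e ▸ (h1 t' u').2.1),
      lastLinkHasType_unique (h1 t u).2.2 (e ▸ (h1 t' u').2.2)⟩
  have e : oneRotationOrbits a b j x y s = {f .T .T, f .T .N, f .N .T, f .N .N} := by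
    ext q
    simp only [mem_insert_iff, mem_singleton_iff]
    constructor
    · intro hq
      obtain ⟨t, t', rfl⟩ := h2 q hq
      cases t <;> cases t' <;> simp
    · rintro (rfl | rfl | rfl | rfl) <;> exact (h1 _ _).1
  have n1 : f .T .T ∉ ({f .T .N, f .N .T, f .N .N} : Set (Fin j → Plane)) := by
    rintro (e | e | e) <;> simpa using hne e
  have n2 : f .T .N ∉ ({f .N .T, f .N .N} : Set (Fin j → Plane)) := by
    rintro (e | e) <;> simpa using hne e
  have n3 : f .N .T ∉ ({f .N .N} : Set (Fin j → Plane)) := by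
    intro e; simpa using hne e
  rw [e, encard_insert_of_notMem n1, encard_insert_of_notMem n2, encard_insert_of_notMem n3,
    encard_singleton]
  norm_num

/-! ### Counting the orbits -/

lemma SmallRange.hasFourOrbits {a b c₀ c₁ : ℝ} (hS : SmallRange a b c₀ c₁) {j : ℕ} (hj : 4 ≤ j)
    (hlow : 4 * j * (c₀ * a) ≤ 2) (hup : 20 ≤ 2 * j * (c₁ * b)) {r ψ r' ψ' : ℝ}
    (hr : NearOne a b c₀ r) (hr' : NearOne a b c₀ r') (hψ : |ψ' - ψ| ≤ 1)
    (hx : polarPoint a b r ψ ∈ ellipseInterior a b) :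
    HasFourOrbits a b j (polarPoint a b r ψ) (polarPoint a b r' ψ') Sense.counterclockwise := by
  choose c m hm using hS.exists_connects hr hr' hψ hlow hup
  refine ⟨fun t t' => impactPoints a b j (m t t') fun k => halfStep a b (c t t') (m t t' k),
    fun t t' => ⟨?_, hS.linkTypes_of_connects (by omega) hr hr' hψ (hm t t')⟩, fun q hq => ?_⟩
  · exact (mem_oneRotationOrbits_iff hS.b_pos hS.b_le (by omega) hx _).2
      ⟨_, _, hS.isChordOrbit_of_connects hr hr' hψ (hm t t'), rfl⟩
  · obtain ⟨m', h', ho, rfl⟩ :=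
      (mem_oneRotationOrbits_iff hS.b_pos hS.b_le (by omega) hx _).1 hq
    obtain ⟨t, t', c'', m'', hc, he⟩ :=
      hS.exists_connects_of_isChordOrbit hj hr hr' hψ hlow hup ho
    refine ⟨t, t', he.trans ?_⟩
    obtain ⟨rfl, hmm⟩ := hS.connects_unique hr hr' (by omega) hc (hm t t')
    funext k
    simp only [impactPoints, hmm k k.2.le]

/-! ### The neighborhood of the diagonal and the choice of constants. -/

/-- The points that are near to the boundary and to each other, in relative coordinates. -/
def nearDiagonal (a b κ : ℝ) : Set (Plane × Plane) :=
  {p | 1 - κ < p.1 0 ^ 2 / a ^ 2 + p.1 1 ^ 2 / b ^ 2 ∧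
    1 - κ < p.2 0 ^ 2 / a ^ 2 + p.2 1 ^ 2 / b ^ 2 ∧
    9 / 10 < p.1 0 * p.2 0 / a ^ 2 + p.1 1 * p.2 1 / b ^ 2}

lemma isOpen_nearDiagonal (a b κ : ℝ) : IsOpen (nearDiagonal a b κ) := by
  have h1 : Continuous fun p : Plane × Plane => p.1 0 ^ 2 / a ^ 2 + p.1 1 ^ 2 / b ^ 2 := by
    fun_prop
  have h2 : Continuous fun p : Plane × Plane => p.2 0 ^ 2 / a ^ 2 + p.2 1 ^ 2 / b ^ 2 := by
    fun_prop
  have h3 : Continuous fun p : Plane × Plane =>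
      p.1 0 * p.2 0 / a ^ 2 + p.1 1 * p.2 1 / b ^ 2 := by
    fun_prop
  exact (isOpen_lt continuous_const h1).inter
    ((isOpen_lt continuous_const h2).inter (isOpen_lt continuous_const h3))

lemma mem_nearDiagonal {a b κ : ℝ} (hκ : 0 < κ) {p : Plane} (hp : p ∈ ellipseBoundary a b) :
    (p, p) ∈ nearDiagonal a b κ := by
  have hp : p 0 ^ 2 / a ^ 2 + p 1 ^ 2 / b ^ 2 = 1 := hp
  refine ⟨by linarith, by linarith, ?_⟩
  change 9 / 10 < p 0 * p 0 / a ^ 2 + p 1 * p 1 / b ^ 2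
  rw [← sq, ← sq, hp]
  norm_num

lemma conj_mem_nearDiagonal {a b κ : ℝ} {x y : Plane} (h : (x, y) ∈ nearDiagonal a b κ) :
    (conj x, conj y) ∈ nearDiagonal a b κ := by
  simpa [nearDiagonal] using h

lemma conj_mem_interior {a b : ℝ} {x : Plane} (h : x ∈ ellipseInterior a b) :
    conj x ∈ ellipseInterior a b := by
  simpa [ellipseInterior] using h

lemma exists_polarPoint_eq {a b : ℝ} (hb : 0 < b) (hab : b ≤ a) {x : Plane}
    (hx : x 0 ^ 2 / a ^ 2 + x 1 ^ 2 / b ^ 2 ≠ 0) :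
    ∃ r ψ, 0 < r ∧ x = polarPoint a b r ψ ∧ x 0 ^ 2 / a ^ 2 + x 1 ^ 2 / b ^ 2 = r ^ 2 := by
  have ha := hb.trans_le hab
  rw [← div_pow, ← div_pow] at hx ⊢
  obtain ⟨r, ψ, hr, h0, h1⟩ := exists_polar hx
  refine ⟨r, ψ, hr, ?_, ?_⟩
  · apply plane_ext
    · change x 0 = a * (r * cos ψ)
      rw [← h0]; field_simp
    · change x 1 = b * (r * sin ψ)
      rw [← h1]; field_simp
  · rw [h0, h1]
    linear_combination r ^ 2 * sin_sq_add_cos_sq ψ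

lemma SmallRange.hasFourOrbits_of_mem_nearDiagonal {a b c₀ c₁ : ℝ} (hS : SmallRange a b c₀ c₁)
    {j : ℕ} (hj : 4 ≤ j) (hlow : 4 * j * (c₀ * a) ≤ 2) (hup : 20 ≤ 2 * j * (c₁ * b))
    {x y : Plane} (hx : x ∈ ellipseInterior a b) (hy : y ∈ ellipseInterior a b)
    (hxy : (x, y) ∈ nearDiagonal a b ((c₀ * b) ^ 2 * (b / (16 * a)))) :
    HasFourOrbits a b j x y Sense.counterclockwise := by
  have ha := hS.a_pos
  have hb := hS.b_pos
  have hκ : (c₀ * b) ^ 2 * (b / (16 * a)) ≤ 1 := by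
    have h1 := hS.lower_mul_b_pos
    have h2 := hS.lower_mul_b_le
    apply mul_le_one₀ (by nlinarith) (by positivity)
    rw [div_le_one (by positivity)]
    linarith [hS.b_le]
  obtain ⟨h1, h2, h3⟩ := hxy
  simp only at h1 h2 h3
  obtain ⟨r, ψ, hr, hxp, hxr⟩ := exists_polarPoint_eq hb hS.b_le (x := x) (by linarith)
  obtain ⟨r', ψ', hr', hyp, hyr⟩ := exists_polarPoint_eq hb hS.b_le (x := y) (by linarith)
  have hr1 : r < 1 := by
    have : r ^ 2 < 1 := hxr ▸ hx
    nlinarith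
  have hr1' : r' < 1 := by
    have : r' ^ 2 < 1 := hyr ▸ hy
    nlinarith
  have hcos : 9 / 10 < cos (ψ' - ψ) := by
    have e : x 0 * y 0 / a ^ 2 + x 1 * y 1 / b ^ 2 = r * r' * cos (ψ' - ψ) := by
      rw [hxp, hyp, cos_sub]
      change a * (r * cos ψ) * (a * (r' * cos ψ')) / a ^ 2 +
        b * (r * sin ψ) * (b * (r' * sin ψ')) / b ^ 2 = _
      field_simp
    rw [e] at h3
    have h4 : 0 < r * r' := mul_pos hr hr'
    have h5 : r * r' < 1 := by nlinarith
    nlinarith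
  obtain ⟨n, hn⟩ := exists_add_int_mul_two_pi_mem (ψ' - ψ)
  have hψ : |ψ' + n * (2 * π) - ψ| ≤ 1 := by
    rw [show ψ' + n * (2 * π) - ψ = ψ' - ψ + n * (2 * π) by ring]
    by_contra! h
    -- The threshold `9/10` exceeds `cos 1`, so the polar angles differ by at most `1` for a
    -- suitable lift.
    have h4 := cos_le_cos_of_nonneg_of_le_pi zero_le_one (abs_le.2 ⟨hn.1.le, hn.2⟩) h.le
    rw [cos_abs, cos_add_int_mul_two_pi] at h4
    linarith [cos_one_le]
  rw [hyp, ← polarPoint_add_int_mul_two_pi a b r' ψ' n]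
  rw [hxp] at hx ⊢
  exact hS.hasFourOrbits hj hlow hup ⟨hr, hr1, by linarith⟩ ⟨hr', hr1', by linarith⟩ hψ hx

lemma exists_forall_smallRange {a b : ℝ} (hb : 0 < b) (hab : b ≤ a) :
    ∃ J : ℕ, 4 ≤ J ∧ ∀ j : ℕ, J ≤ j → SmallRange a b (1 / (2 * a * j)) (10 / (b * j)) := by
  have ha := hb.trans_le hab
  have hlim : Tendsto (fun j : ℕ => 10 / b / (j : ℝ)) atTop (𝓝 0) :=
    tendsto_const_div_atTop_nhds_zero_nat _
  have h1 : ∀ᶠ j : ℕ in atTop, 10 / b / (j : ℝ) * a < 1 / 20 := by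
    have := hlim.mul_const a
    rw [zero_mul] at this
    exact this.eventually_lt_const (by norm_num)
  have h2 : ∀ᶠ j : ℕ in atTop, 2 * (10 / b / (j : ℝ)) * (a ^ 2 / b) < 1 / 4 := by
    have := (hlim.const_mul 2).mul_const (a ^ 2 / b)
    rw [mul_zero, zero_mul] at this
    exact this.eventually_lt_const (by norm_num)
  have h3 : ∀ᶠ j : ℕ in atTop,
      ((a ^ 2 - b ^ 2) / (a ^ 2 + b ^ 2)) ^ 2 + (10 / b / (j : ℝ) * a) ^ 2 < 1 := by
    have := ((hlim.mul_const a).pow 2).const_add (((a ^ 2 - b ^ 2) / (a ^ 2 + b ^ 2)) ^ 2)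
    rw [zero_mul, zero_pow two_ne_zero, add_zero] at this
    -- The limit is below `1` because `0 < b`, that is, the ellipse is nondegenerate.
    refine this.eventually_lt_const ?_
    rw [div_pow, div_lt_one (by positivity)]
    nlinarith [pow_pos ha 2, pow_pos hb 2, mul_pos (pow_pos ha 2) (pow_pos hb 2)]
  obtain ⟨J, hJ⟩ := eventually_atTop.1 (h1.and (h2.and h3))
  refine ⟨max 4 J, le_max_left _ _, fun j hj => ?_⟩
  obtain ⟨i1, i2, i3⟩ := hJ j ((le_max_right _ _).trans hj)
  have hj0 : (0 : ℝ) < j := by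
    have : 0 < j := by omega
    exact_mod_cast this
  rw [div_div] at i1 i2 i3
  refine ⟨hb, hab, by positivity, ?_, i1.le, i2.le, i3⟩
  rw [div_le_div_iff₀ (by positivity) (by positivity)]
  have : b * j ≤ a * j := by gcongr
  linarith [mul_pos ha hj0]

end EllipseBilliard

end

theorem mainTheorem9 (a b : ℝ) (hb : 0 < b) (hab : b ≤ a) :
    ∃ J : ℕ, ∀ j : ℕ, J ≤ j →
      ∃ U : Set (EllipseBilliard.Plane × EllipseBilliard.Plane),
        IsOpen U ∧ (∀ p ∈ EllipseBilliard.ellipseBoundary a b, (p, p) ∈ U) ∧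
        ∀ x ∈ EllipseBilliard.ellipseInterior a b, ∀ y ∈ EllipseBilliard.ellipseInterior a b,
          (x, y) ∈ U → ∀ s : EllipseBilliard.Sense,
            (EllipseBilliard.oneRotationOrbits a b j x y s).encard = 4 ∧
            ∀ first last : EllipseBilliard.LinkType,
              ∃! q : Fin j → EllipseBilliard.Plane,
                q ∈ EllipseBilliard.oneRotationOrbits a b j x y s ∧
                EllipseBilliard.FirstLinkHasType a b x y q first ∧
                EllipseBilliard.LastLinkHasType a b x y q last := by
  open EllipseBilliard in
  obtain ⟨J, hJ4, hJ⟩ := exists_forall_smallRange hb hab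
  refine ⟨J, fun j hj => ?_⟩
  have hS := hJ j hj
  have ha := hS.a_pos
  have hj0 : (0 : ℝ) < j := by
    have : 0 < j := by omega
    exact_mod_cast this
  -- The range of `c` scales as `1 / j`, chosen so that both bounds on the total advance hold with
  -- equality.
  have hlow : 4 * j * (1 / (2 * a * j) * a) ≤ 2 := by
    apply le_of_eq; field_simp; norm_num
  have hup : 20 ≤ 2 * j * (10 / (b * j) * b) := by
    apply le_of_eq; field_simp; norm_num
  have hκ := hS.lower_mul_b_pos
  refine ⟨nearDiagonal a b ((1 / (2 * a * j) * b) ^ 2 * (b / (16 * a))), isOpen_nearDiagonal a b _,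
    fun p hp => mem_nearDiagonal (by positivity) hp, fun x hx y hy hxy s => ?_⟩
  have h : HasFourOrbits a b j x y s := by
    cases s with
    | counterclockwise =>
      exact hS.hasFourOrbits_of_mem_nearDiagonal (hJ4.trans hj) hlow hup hx hy hxy
    | clockwise =>
      have := (hS.hasFourOrbits_of_mem_nearDiagonal (hJ4.trans hj) hlow hup
        (conj_mem_interior hx) (conj_mem_interior hy) (conj_mem_nearDiagonal hxy)).conj
      rwa [conj_conj, conj_conj] at this
  exact ⟨h.encard_eq, h.existsUnique⟩
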